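/- Theorem. An instance consists of a finite node set $V$, a finite family $E$ of static bidirected links on $V$ (a multigraph), the set $\mathcal E$ of reconfigurable bidirected links, one for every pair of distinct nodes (the complete graph on $V$), a capacity $c(e)\ge 0$ for each of the two directions of every link of $E\cup\mathcal E$, and a demand matrix $D=(d_{u,v})_{u,v\in V}$ with entries $d_{u,v}\ge 0$. All numbers are rational and given in binary. For a matching $M\subseteq\mathcal E$, let $N(M)=(V,E\cup M,c)$, and write $\vec E\cup\vec M$ for its directed links (both directions of every link of $E\cup M$). A flow serving $D$ in $N(M)$ is a family of functions $f_{u,v}:\vec E\cup\vec M\to\mathbb R_{\ge 0}$, one for each pair of nodes, such that - (SN, splittable and non-segregated routing) each $f_{u,v}$ is a flow from $u$ to $v$ of net size $d_{u,v}$, i.e. the outflow minus the inflow at every node $w$ equals $d_{u,v}([w=u]-[w=v])$; or - (UN, unsplittable and non-segregated routing) each $f_{u,v}$ with $d_{u,v}>0$ equals $d_{u,v}$ on the links of one simple directed path from $u$ to $v$ in $N(M)$ and $0$ elsewhere, and $f_{u,v}=0$ if $d_{u,v}=0$. In both models static links and links of $M$ may be combined freely. Flows may exceed capacities. The load of a directed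 link $e$ is $\sum_{u,v}f_{u,v}(e)/c(e)$, and the congestion of $N(M)$ is the minimum, over all flows serving $D$ in $N(M)$ under the given routing model, of the maximum load of a link in $\vec E\cup\vec M$ (it is $\infty$ if there is no such flow). The problem MCRN asks for a matching $M\subseteq\mathcal E$ for which the congestion of $N(M)$ is minimum. For each of the two routing models SN and UN, there is an algorithm that, for every instance in which $D$ has exactly one positive entry (single commodity) and all directed links have the same capacity $a>0$ (uniform capacities), finds in time polynomial in the size of the input a matching $M$ that solves MCRN. -/

import Mathlib

open scoped NNReal ENNReal

namespace MCRN

/-! ### Networks, demands, reconfigurations -/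

/-- The directed links of a reconfigurable network on the nodes `Fin n` with `m` static links.
`Sum.inl (e, b)` is one of the two directions of the static bidirected link number `e`;
`Sum.inr d` is a directed reconfigurable link, that is, an ordered pair of distinct nodes (the
reconfigurable links form the complete graph on the nodes). -/
abbrev Link (n m : ℕ) : Type := (Fin m × Bool) ⊕ (⊤ : SimpleGraph (Fin n)).Dart

/-- An instance: a reconfigurable network together with a demand matrix. The static links are an
indexed family, so that parallel links are possible. The numbers given in the input are
nonnegative rationals. -/
structure Instance where
  /-- number of nodes -/
  n : ℕ
  /-- number of static bidirected links -/
  m : ℕ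
  /-- the two endpoints of each static link -/
  ends : Fin m → Fin n × Fin n
  /-- capacity of each directed static and each directed reconfigurable link -/
  cap : Link n m → ℚ≥0
  /-- the demand matrix -/
  demand : Fin n → Fin n → ℚ≥0

namespace Instance

variable (I : Instance)

/-- Tail of a directed link. -/
def src : Link I.n I.m → Fin I.n
  | Sum.inl (e, false) => (I.ends e).1
  | Sum.inl (e, true) => (I.ends e).2
  | Sum.inr d => d.fst

/-- Head of a directed link. -/
def dst : Link I.n I.m → Fin I.n
  | Sum.inl (e, false) => (I.ends e).2
  | Sum.inl (e, true) => (I.ends e).1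
  | Sum.inr d => d.snd

/-- The demand matrix contains exactly one commodity, i.e. exactly one positive entry. -/
def SingleCommodity : Prop :=
  ∃! p : Fin I.n × Fin I.n, 0 < I.demand p.1 p.2

/-- All directed links, static and reconfigurable, have the same positive capacity. -/
def UniformCapacities : Prop :=
  ∃ a : ℚ≥0, 0 < a ∧ ∀ e : Link I.n I.m, I.cap e = a

/-- A reconfiguration is a matching in the complete graph: a set of links (a simple graph) in which
every node has at most one partner. -/
def IsReconfiguration (M : SimpleGraph (Fin I.n)) : Prop :=
  ∀ u v w, M.Adj u v → M.Adj u w → v = w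

/-- The directed links present in the network reconfigured by `M`: all directed static links, and
both directions of each link of `M`. -/
def Present (M : SimpleGraph (Fin I.n)) : Link I.n I.m → Prop
  | Sum.inl _ => True
  | Sum.inr d => M.Adj d.fst d.snd

/-! ### Flows and congestion -/

/-- `IsWalk u p v`: the list `p` of directed links is a directed walk from `u` to `v`. -/
def IsWalk : Fin I.n → List (Link I.n I.m) → Fin I.n → Prop
  | u, [], v => u = v
  | u, e :: p, v => I.src e = u ∧ IsWalk (I.dst e) p v

/-- A directed path (no repeated node) from `u` to `v` in the network reconfigured by `M`. -/
def IsPath (M : SimpleGraph (Fin I.n)) (u : Fin I.n) (p : List (Link I.n I.m)) (v : Fin I.n) :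
    Prop :=
  I.IsWalk u p v ∧ (u :: p.map I.dst).Nodup ∧ ∀ e ∈ p, I.Present M e

/-- A family of subflows: `f i j e` is the amount of the demand from `i` to `j` sent over the
directed link `e`. -/
abbrev Flow : Type := Fin I.n → Fin I.n → Link I.n I.m → ℝ≥0

end Instance

/-- The two non-segregated routing models: splittable (`SN`) and unsplittable (`UN`). In both, static
links and links of the reconfiguration may be combined freely. -/
inductive Routing
  | SN
  | UN

namespace Instance

variable (I : Instance)

/-- `f` is carried by the present links, and each subflow `f i j` is a flow from `i` to `j` of net
size `demand i j`: at each node `v`, outflow minus inflow is `demand i j` times `[v = i] - [v = j]`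
(written without subtraction). -/
def ServesSplittable (M : SimpleGraph (Fin I.n)) (f : I.Flow) : Prop :=
  ∀ i j : Fin I.n,
    (∀ e, ¬ I.Present M e → f i j e = 0) ∧
    ∀ v : Fin I.n,
      (∑ e with I.src e = v, f i j e) + (if v = j then (I.demand i j : ℝ≥0) else 0) =
      (∑ e with I.dst e = v, f i j e) + (if v = i then (I.demand i j : ℝ≥0) else 0)

/-- Each positive demand is sent entirely along a single directed path of present links. -/
def ServesUnsplittable (M : SimpleGraph (Fin I.n)) (f : I.Flow) : Prop :=
  ∀ i j : Fin I.n,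
    (I.demand i j = 0 → ∀ e, f i j e = 0) ∧
    (0 < I.demand i j → ∃ p, I.IsPath M i p j ∧
      ∀ e, (e ∈ p → f i j e = (I.demand i j : ℝ≥0)) ∧ (e ∉ p → f i j e = 0))

/-- `f` serves all demands in the network reconfigured by `M` under the routing model. -/
def Serves : Routing → SimpleGraph (Fin I.n) → I.Flow → Prop
  | Routing.SN => I.ServesSplittable
  | Routing.UN => I.ServesUnsplittable

/-- Load of a directed link: total flow divided by capacity. (In `ℝ≥0∞` we have `0 / 0 = 0` and
`x / 0 = ∞` for `x > 0`.) -/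
noncomputable def load (f : I.Flow) (e : Link I.n I.m) : ℝ≥0∞ :=
  ((∑ i, ∑ j, f i j e : ℝ≥0) : ℝ≥0∞) / ((I.cap e : ℝ≥0) : ℝ≥0∞)

/-- Maximum load over the directed links present in the network reconfigured by `M`. -/
noncomputable def maxLoad (M : SimpleGraph (Fin I.n)) (f : I.Flow) : ℝ≥0∞ :=
  ⨆ (e : Link I.n I.m) (_ : I.Present M e), I.load f e

/-- The congestion of the network reconfigured by `M`: the least maximum load of a flow serving the
demands, `∞` if no flow serves them. -/
noncomputable def congestion (τ : Routing) (M : SimpleGraph (Fin I.n)) : ℝ≥0∞ :=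
  ⨅ (f : I.Flow) (_ : I.Serves τ M f), I.maxLoad M f

/-- `M` solves the problem: it is a reconfiguration, its congestion is attained by a flow, and no
reconfiguration has smaller congestion. -/
def IsSolution (τ : Routing) (M : SimpleGraph (Fin I.n)) : Prop :=
  I.IsReconfiguration M ∧
  (∃ f : I.Flow, I.Serves τ M f ∧ I.maxLoad M f = I.congestion τ M) ∧
  ∀ M' : SimpleGraph (Fin I.n), I.IsReconfiguration M' → I.congestion τ M ≤ I.congestion τ M'

/-! ### Input and output format -/

/-- A nonnegative rational is given by its numerator and its denominator in lowest terms. -/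
def encodeRat (q : ℚ≥0) : List ℕ := [q.num, q.den]

/-- The `n × n` table of a matrix of nonnegative rationals, row by row. -/
def encodeTable {n : ℕ} (A : Fin n → Fin n → ℚ≥0) : List ℕ :=
  (List.finRange n).flatMap fun i => (List.finRange n).flatMap fun j => encodeRat (A i j)

/-- The input sequence of an instance: the numbers of nodes and of static links; for each static
link, its endpoints and its capacities in the two directions; the capacities of the directed
reconfigurable links, as a table (with `0` on the diagonal, where there is no link); the demand
matrix. -/
def encode : List ℕ :=
  [I.n, I.m] ++
  ((List.finRange I.m).flatMap fun e =>
    [((I.ends e).1 : ℕ), ((I.ends e).2 : ℕ)] ++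
      encodeRat (I.cap (Sum.inl (e, false))) ++ encodeRat (I.cap (Sum.inl (e, true)))) ++
  encodeTable (fun i j => if h : i ≠ j then I.cap (Sum.inr ⟨(i, j), h⟩) else 0) ++
  encodeTable I.demand

/-- The sequence `out` represents the matching `M` as a table of partners: entry `u` is `v + 1` if
`u` is matched to `v`, and `0` if `u` is unmatched. -/
def Represents (out : ℕ → ℕ) (M : SimpleGraph (Fin I.n)) : Prop :=
  ∀ u : Fin I.n,
    (∃ v : Fin I.n, M.Adj u v ∧ out u = (v : ℕ) + 1) ∨ ((∀ v, ¬ M.Adj u v) ∧ out u = 0)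

end Instance

/-! ### Random access machines and polynomial time

Programs of a random access machine whose memory consists of arrays of natural numbers with
indirect addressing. A program mentions finitely many arrays. The arithmetic operations are addition
and truncated subtraction only, and each elementary operation costs one step. Hence one step
lengthens the longest stored number by at most one bit, and a run of `t` steps on an input of `s`
bits can be simulated by a Turing machine in time polynomial in `s + t`, and vice versa. -/

/-- The memory: `σ a i` is the content of cell `i` of array `a`. -/
abbrev Memory : Type := ℕ → ℕ → ℕ

/-- Expressions. -/
inductive Expr
  | const (k : ℕ)
  | read (a : ℕ) (i : Expr)
  | add (x y : Expr)
  | sub (x y : Expr)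

namespace Expr

/-- The value of an expression. -/
def eval (σ : Memory) : Expr → ℕ
  | const k => k
  | read a i => σ a (i.eval σ)
  | add x y => x.eval σ + y.eval σ
  | sub x y => x.eval σ - y.eval σ

/-- The number of steps needed to evaluate an expression: one for each operation in it. -/
def cost : Expr → ℕ
  | const _ => 1
  | read _ i => i.cost + 1
  | add x y => x.cost + y.cost + 1
  | sub x y => x.cost + y.cost + 1

end Expr

/-- Programs. Conditions count as true when their value is nonzero. -/
inductive Program
  | skip
  | write (a : ℕ) (i x : Expr)
  | seq (P Q : Program)
  | ite (b : Expr) (P Q : Program)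
  | loop (b : Expr) (P : Program)

/-- `Runs P σ t σ'`: started in memory `σ`, the program `P` halts after exactly `t` steps in memory
`σ'`. (`loop b P` repeats `P` as long as `b` is true.) -/
inductive Runs : Program → Memory → ℕ → Memory → Prop
  | skip (σ : Memory) : Runs Program.skip σ 1 σ
  | write (a : ℕ) (i x : Expr) (σ : Memory) :
      Runs (Program.write a i x) σ (i.cost + x.cost + 1)
        (Function.update σ a (Function.update (σ a) (i.eval σ) (x.eval σ)))
  | seq {P Q : Program} {σ σ' σ'' : Memory} {t t' : ℕ}
      (hP : Runs P σ t σ') (hQ : Runs Q σ' t' σ'') :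
      Runs (Program.seq P Q) σ (t + t') σ''
  | iteTrue {b : Expr} {P Q : Program} {σ σ' : Memory} {t : ℕ}
      (hb : b.eval σ ≠ 0) (hP : Runs P σ t σ') :
      Runs (Program.ite b P Q) σ (b.cost + 1 + t) σ'
  | iteFalse {b : Expr} {P Q : Program} {σ σ' : Memory} {t : ℕ}
      (hb : b.eval σ = 0) (hQ : Runs Q σ t σ') :
      Runs (Program.ite b P Q) σ (b.cost + 1 + t) σ'
  | loopTrue {b : Expr} {P : Program} {σ σ' σ'' : Memory} {t t' : ℕ}
      (hb : b.eval σ ≠ 0) (hP : Runs P σ t σ') (hL : Runs (Program.loop b P) σ' t' σ'') :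
      Runs (Program.loop b P) σ (b.cost + 1 + t + t') σ''
  | loopFalse {b : Expr} {P : Program} {σ : Memory}
      (hb : b.eval σ = 0) :
      Runs (Program.loop b P) σ (b.cost + 1) σ

/-- The initial memory: the input sequence is in array `0`, all other cells contain `0`. -/
def initial (w : List ℕ) : Memory := fun a i => if a = 0 then w.getD i 0 else 0

/-- The size of an input sequence: the total number of binary digits, plus one separator for each
entry. -/
def inputSize (w : List ℕ) : ℕ := (w.map fun x => Nat.size x + 1).sum

/-- The search problem, given by its input encoding, its set of admissible inputs, and the relation
`R x out` between inputs and correct outputs, is solvable in polynomial time: some program halts on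
every admissible input within a number of steps polynomial in the input size, with a correct output
in array `1`. -/
def PolyTimeSolvable {α : Type} (enc : α → List ℕ) (admissible : α → Prop)
    (R : α → (ℕ → ℕ) → Prop) : Prop :=
  ∃ (P : Program) (p : Polynomial ℕ), ∀ x : α, admissible x →
    ∃ (t : ℕ) (σ : Memory),
      Runs P (initial (enc x)) t σ ∧ t ≤ p.eval (inputSize (enc x)) ∧ R x (σ 1)

end MCRN

/-! Let d be the demand from s to t; if s = t, the zero flow serves it. Under UN the first link of
any path carries all of d, so no matching gets below load d/a, and the direct link attains it
(`isSolution_edge`).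

Under SN, let C contain s but not t. Each node of a matching has one partner, so at most min(|C|,
|V∖C|) of its links leave C. Hence, if `staticCut` of C plus this minimum is at most k, every
matching has congestion at least d/(ka) (`le_maxLoad_of_cut`). To find the best such cut, join every
node in both directions to an additional hub, with unit capacities: the hub arcs add |V∖C| or |C| to
a cut, depending on the side of the hub. In an integral maximum flow of value k each node has net
exchange -1, 0 or 1 with the hub, and conservation at the hub makes senders and receivers equally
numerous. Matching them in an arbitrary way replaces the detours through the hub, and scaling by d/k
yields maximum load at most d/(ka) (`isSolution_of_flow_of_cut`, `HubNetwork.isSolution`).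

The flow is found by augmenting paths. A unit flow is stored by reversing its arcs, so the residual
network is the reoriented digraph itself, and the nodes reachable from s after the last augmentation
form a tight cut (`ReversesFlow.cut_le`). With N = 2m + 2n arcs there are at most N/2 augmentations,
hence polynomial time. -/

namespace MCRN

/-! ### Total correctness with time bounds for random access programs -/

/-- `P` halts from `σ` within `T` steps in a memory satisfying `Q`. -/
def Halts (P : Program) (σ : Memory) (T : ℕ) (Q : Memory → Prop) : Prop :=
  ∃ t σ', Runs P σ t σ' ∧ t ≤ T ∧ Q σ'

theorem Halts.mono {P : Program} {σ : Memory} {T T' : ℕ} {Q Q' : Memory → Prop}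
    (h : Halts P σ T Q) (hT : T ≤ T') (hQ : ∀ σ', Q σ' → Q' σ') : Halts P σ T' Q' := by
  obtain ⟨t, σ', hr, ht, hq⟩ := h
  exact ⟨t, σ', hr, ht.trans hT, hQ _ hq⟩

theorem Halts.seq {P P' : Program} {σ : Memory} {T T' T'' : ℕ} {Q Q' : Memory → Prop}
    (h : Halts P σ T Q) (h' : ∀ σ', Q σ' → Halts P' σ' T' Q') (hT : T + T' ≤ T'') :
    Halts (Program.seq P P') σ T'' Q' := by
  obtain ⟨t, σ', hr, ht, hq⟩ := h
  obtain ⟨t', σ'', hr', ht', hq'⟩ := h' σ' hq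
  exact ⟨t + t', σ'', Runs.seq hr hr', by omega, hq'⟩

theorem Halts.ite {b : Expr} {P P' : Program} {σ : Memory} {T T' : ℕ} {Q : Memory → Prop}
    (h : b.eval σ ≠ 0 → Halts P σ T Q) (h' : b.eval σ = 0 → Halts P' σ T Q)
    (hT : b.cost + 1 + T ≤ T') : Halts (Program.ite b P P') σ T' Q := by
  by_cases hb : b.eval σ = 0
  · obtain ⟨t, σ', hr, ht, hq⟩ := h' hb
    exact ⟨_, σ', Runs.iteFalse hb hr, by omega, hq⟩
  · obtain ⟨t, σ', hr, ht, hq⟩ := h hb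
    exact ⟨_, σ', Runs.iteTrue hb hr, by omega, hq⟩

/-- Total correctness of loops; the invariant is indexed by the variant. -/
theorem Halts.loop {b : Expr} {P : Program} {Q : Memory → Prop} (T : ℕ) (Inv : ℕ → Memory → Prop)
    {r : ℕ} {σ : Memory} {T' : ℕ} (h : Inv r σ)
    (hbody : ∀ r σ, Inv r σ → b.eval σ ≠ 0 → Halts P σ T fun σ' => ∃ r' < r, Inv r' σ')
    (hexit : ∀ r σ, Inv r σ → b.eval σ = 0 → Q σ) (hT : (r + 1) * (b.cost + 1 + T) ≤ T') :
    Halts (Program.loop b P) σ T' Q := by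
  suffices H : Halts (Program.loop b P) σ ((r + 1) * (b.cost + 1 + T)) Q from
    H.mono hT fun _ h => h
  clear hT
  induction r using Nat.strong_induction_on generalizing σ with
  | _ r ih =>
    by_cases hb : b.eval σ = 0
    · exact ⟨_, σ, Runs.loopFalse hb, by nlinarith, hexit r σ h hb⟩
    · obtain ⟨t, σ', hr, ht, r', hlt, hi⟩ := hbody r σ h hb
      obtain ⟨t', σ'', hr', ht', hq⟩ := ih r' hlt hi
      refine ⟨_, σ'', Runs.loopTrue hb hr hr', ?_, hq⟩
      have : (r' + 1) * (b.cost + 1 + T) ≤ r * (b.cost + 1 + T) := Nat.mul_le_mul_right _ hlt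
      linarith [Nat.succ_mul r (b.cost + 1 + T)]

namespace Program

/-- The arrays written by a program. -/
def writes : Program → List ℕ
  | skip => []
  | write a _ _ => [a]
  | seq P Q => P.writes ++ Q.writes
  | ite _ P Q => P.writes ++ Q.writes
  | loop _ P => P.writes

/-- The program contains no loop. -/
def LoopFree : Program → Prop
  | skip => True
  | write _ _ _ => True
  | seq P Q => P.LoopFree ∧ Q.LoopFree
  | ite _ P Q => P.LoopFree ∧ Q.LoopFree
  | loop _ _ => False

/-- The effect of a loop-free program. -/
def exec : Program → Memory → Memory
  | skip, σ => σ
  | write a i x, σ => Function.update σ a (Function.update (σ a) (i.eval σ) (x.eval σ))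
  | seq P Q, σ => Q.exec (P.exec σ)
  | ite b P Q, σ => if b.eval σ ≠ 0 then P.exec σ else Q.exec σ
  | loop _ _, σ => σ

/-- An upper bound on the number of steps of a loop-free program. -/
def maxCost : Program → ℕ
  | skip => 1
  | write _ i x => i.cost + x.cost + 1
  | seq P Q => P.maxCost + Q.maxCost
  | ite b P Q => b.cost + 1 + (P.maxCost + Q.maxCost)
  | loop _ _ => 0

end Program

/-- The specification of each phase mentions only what the phase establishes; this supplies the
survival of all data in other arrays. -/
theorem Runs.frame {P : Program} {σ σ' : Memory} {t : ℕ} (h : Runs P σ t σ') :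
    ∀ a ∉ P.writes, σ' a = σ a := by
  induction h with
  | skip => simp
  | write a i x σ =>
    intro b hb
    exact Function.update_of_ne (by simpa [Program.writes] using hb) _ _
  | seq _ _ ih ih' =>
    intro a ha
    simp only [Program.writes, List.mem_append, not_or] at ha
    rw [ih' a ha.2, ih a ha.1]
  | iteTrue _ _ ih =>
    intro a ha
    simp only [Program.writes, List.mem_append, not_or] at ha
    exact ih a ha.1
  | iteFalse _ _ ih =>
    intro a ha
    simp only [Program.writes, List.mem_append, not_or] at ha
    exact ih a ha.2
  | loopTrue _ _ _ ih ih' =>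
    intro a ha
    rw [ih' a ha, ih a ha]
  | loopFalse => simp

theorem Halts.frame {P : Program} {σ : Memory} {T : ℕ} {Q : Memory → Prop} (h : Halts P σ T Q) :
    Halts P σ T fun σ' => Q σ' ∧ ∀ a ∉ P.writes, σ' a = σ a := by
  obtain ⟨t, σ', hr, ht, hq⟩ := h
  exact ⟨t, σ', hr, ht, hq, hr.frame⟩

theorem Program.LoopFree.runs {P : Program} (hP : P.LoopFree) (σ : Memory) :
    ∃ t ≤ P.maxCost, Runs P σ t (P.exec σ) := by
  induction P generalizing σ with
  | skip => exact ⟨1, le_rfl, Runs.skip σ⟩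
  | write a i x => exact ⟨_, le_rfl, Runs.write a i x σ⟩
  | seq P Q ihP ihQ =>
    obtain ⟨t, ht, hr⟩ := ihP hP.1 σ
    obtain ⟨t', ht', hr'⟩ := ihQ hP.2 (P.exec σ)
    exact ⟨_, Nat.add_le_add ht ht', Runs.seq hr hr'⟩
  | ite b P Q ihP ihQ =>
    by_cases hb : b.eval σ = 0
    · obtain ⟨t, ht, hr⟩ := ihQ hP.2 σ
      refine ⟨b.cost + 1 + t, by simp only [maxCost]; omega, ?_⟩
      simpa [exec, hb] using Runs.iteFalse hb hr
    · obtain ⟨t, ht, hr⟩ := ihP hP.1 σ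
      refine ⟨b.cost + 1 + t, by simp only [maxCost]; omega, ?_⟩
      simpa [exec, hb] using Runs.iteTrue hb hr
  | loop b P ih => exact hP.elim

/-- For a concrete loop body `maxCost` is a closed numeral, so the time bound can be decided, and
the postcondition becomes a computation with `exec`. -/
theorem Program.LoopFree.halts {P : Program} (hP : P.LoopFree) {σ : Memory} {T : ℕ}
    {Q : Memory → Prop} (hT : P.maxCost ≤ T) (h : Q (P.exec σ)) : Halts P σ T Q := by
  obtain ⟨t, ht, hr⟩ := hP.runs σ
  exact ⟨t, _, hr, ht.trans hT, h⟩

end MCRN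

/-! ### Cuts, flows and certificates of optimality -/

namespace MCRN.Instance

variable {I : Instance}

/-- The demand of a single commodity from `s` to `t` over links of capacity `a`. -/
structure IsCommodity (I : Instance) (s t : Fin I.n) (a : ℚ≥0) : Prop where
  pos : 0 < I.demand s t
  zero : ∀ i j, (i, j) ≠ (s, t) → I.demand i j = 0
  cap_pos : 0 < a
  cap : ∀ e, I.cap e = a

theorem IsCommodity.exists (h₁ : I.SingleCommodity) (h₂ : I.UniformCapacities) :
    ∃ s t a, I.IsCommodity s t a := by
  obtain ⟨⟨s, t⟩, hp, hu⟩ := h₁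
  obtain ⟨a, ha, hc⟩ := h₂
  refine ⟨s, t, a, hp, fun i j hij => ?_, ha, hc⟩
  by_contra h
  exact hij (hu (i, j) (pos_iff_ne_zero.2 h))

/-- A single number `c` that bounds every flow in every reconfiguration from below and one flow from
above yields both attainment and optimality. -/
theorem isSolution_of_le {τ : Routing} {M : SimpleGraph (Fin I.n)} (hM : I.IsReconfiguration M)
    {f : I.Flow} (hf : I.Serves τ M f) (c : ℝ≥0∞) (hc : I.maxLoad M f ≤ c)
    (hle : ∀ M' f', I.IsReconfiguration M' → I.Serves τ M' f' → c ≤ I.maxLoad M' f') :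
    I.IsSolution τ M := by
  have key : ∀ M', I.IsReconfiguration M' → c ≤ I.congestion τ M' := fun M' hM' =>
    le_iInf₂ fun f' hf' => hle M' f' hM' hf'
  have h2 : I.congestion τ M ≤ I.maxLoad M f := iInf₂_le f hf
  exact ⟨hM, ⟨f, hf, le_antisymm (hc.trans (key M hM)) h2⟩,
    fun M' hM' => (h2.trans hc).trans (key M' hM')⟩

variable {s t : Fin I.n} {a : ℚ≥0}

theorem isReconfiguration_bot : I.IsReconfiguration ⊥ := fun _ _ _ h => h.elim

theorem maxLoad_zero (M : SimpleGraph (Fin I.n)) : I.maxLoad M (fun _ _ _ => 0) = 0 := by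
  simp [maxLoad, load]

/-- If source and target of the commodity coincide, nothing has to be sent. -/
theorem isSolution_bot_of_eq (τ : Routing) (h : I.IsCommodity s s a) : I.IsSolution τ ⊥ := by
  refine isSolution_of_le isReconfiguration_bot (f := fun _ _ _ => 0) ?_ 0 (maxLoad_zero _).le
    fun _ _ _ _ => zero_le
  cases τ with
  | SN =>
    refine fun i j => ⟨fun _ _ => rfl, fun v => ?_⟩
    by_cases hij : (i, j) = (s, s)
    · simp only [Prod.mk.injEq] at hij
      obtain ⟨rfl, rfl⟩ := hij
      simp
    · simp [h.zero i j hij]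
  | UN =>
    refine fun i j => ⟨fun _ _ => rfl, fun hd => ⟨[], ⟨?_, by simp, by simp⟩, by simp⟩⟩
    by_contra hij
    refine hd.ne' (h.zero i j fun he => hij ?_)
    simp only [Prod.mk.injEq] at he
    exact he.1.trans he.2.symm

theorem IsCommodity.load_le (h : I.IsCommodity s t a) {f : I.Flow} {c : ℝ≥0} (e : Link I.n I.m)
    (hc : f s t e ≤ c) (h0 : ∀ i j, (i, j) ≠ (s, t) → f i j e = 0) :
    I.load f e ≤ (c : ℝ≥0∞) / ((a : ℝ≥0) : ℝ≥0∞) := by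
  have : ∑ i, ∑ j, f i j e = f s t e := by
    rw [← Fintype.sum_prod_type' (f := fun i j => f i j e)]
    exact Finset.sum_eq_single (s, t) (fun p _ hp => h0 p.1 p.2 hp) (by simp)
  rw [load, this, h.cap]
  gcongr

/-- Under splittable routing the subflows of zero demands may be circulations, so the load can
exceed the share of `f s t`; lower bounds need only this inequality. -/
theorem IsCommodity.le_load (h : I.IsCommodity s t a) (f : I.Flow) (e : Link I.n I.m) :
    (f s t e : ℝ≥0∞) / ((a : ℝ≥0) : ℝ≥0∞) ≤ I.load f e := by
  rw [load, h.cap]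
  gcongr
  calc f s t e ≤ ∑ j, f s j e :=
        Finset.single_le_sum (f := fun j => f s j e) (fun _ _ => zero_le) (Finset.mem_univ t)
    _ ≤ ∑ i, ∑ j, f i j e :=
        Finset.single_le_sum (f := fun i => ∑ j, f i j e) (fun _ _ => zero_le) (Finset.mem_univ s)

theorem load_le_maxLoad {M : SimpleGraph (Fin I.n)} (f : I.Flow) {e : Link I.n I.m}
    (he : I.Present M e) : I.load f e ≤ I.maxLoad M f :=
  le_iSup₂ (f := fun e (_ : I.Present M e) => I.load f e) e he

theorem isReconfiguration_edge (s t : Fin I.n) :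
    I.IsReconfiguration (SimpleGraph.edge s t) := by
  intro u v w huv huw
  simp only [SimpleGraph.edge_adj] at huv huw
  grind

/-- An unsplittable commodity is best served by a direct link. -/
theorem isSolution_edge (h : I.IsCommodity s t a) (hst : s ≠ t) :
    I.IsSolution Routing.UN (SimpleGraph.edge s t) := by
  classical
  let e₀ : Link I.n I.m := Sum.inr ⟨(s, t), by simpa using hst⟩
  let f : I.Flow := fun i j e => if (i, j) = (s, t) ∧ e = e₀ then (I.demand s t : ℝ≥0) else 0
  refine isSolution_of_le (isReconfiguration_edge s t) (f := f) ?_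
    (((I.demand s t : ℝ≥0) : ℝ≥0∞) / ((a : ℝ≥0) : ℝ≥0∞)) ?_ ?_
  · refine fun i j => ⟨fun hd e => ?_, fun hd => ?_⟩
    · have : (i, j) ≠ (s, t) := fun he => by
        simp only [Prod.mk.injEq] at he
        rw [he.1, he.2] at hd
        exact h.pos.ne' hd
      exact if_neg fun hh => this hh.1
    · have hij : (i, j) = (s, t) := by
        by_contra hij
        exact hd.ne' (h.zero i j hij)
      simp only [Prod.mk.injEq] at hij
      obtain ⟨rfl, rfl⟩ := hij
      refine ⟨[e₀], ⟨⟨rfl, rfl⟩, by simpa [e₀, dst] using hst, ?_⟩, ?_⟩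
      · simp [e₀, Present, SimpleGraph.edge_adj, hst]
      · intro e
        simp only [List.mem_singleton, f]
        exact ⟨fun he => by simp [he], fun he => by simp [he]⟩
  · refine iSup₂_le fun e _ => h.load_le e ?_ fun i j hij => if_neg fun hh => hij hh.1
    simp only [f]
    split_ifs <;> simp
  -- Since `s ≠ t`, the path of any competing flow has a first link, and that link carries the
  -- entire demand.
  · intro M' f' _ hf'
    obtain ⟨p, ⟨hw, -, hp⟩, hpf⟩ := (hf' s t).2 h.pos
    cases p with
    | nil => exact (hst hw).elim
    | cons e p =>
      refine le_trans ?_ (load_le_maxLoad f' (hp e (by simp)))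
      rw [← (hpf e).1 (by simp)]
      exact h.le_load f' e

/-- The links of a matching that leave a set of nodes are at most as many as its nodes, and as the
nodes outside. -/
theorem card_leaving_le {M : SimpleGraph (Fin I.n)} (hM : I.IsReconfiguration M)
    (C : Finset (Fin I.n)) [DecidableRel M.Adj] :
    (Finset.univ.filter fun d : (⊤ : SimpleGraph (Fin I.n)).Dart =>
      M.Adj d.fst d.snd ∧ d.fst ∈ C ∧ d.snd ∉ C).card ≤ min C.card Cᶜ.card := by
  -- In a matching the tail of a link determines its head and conversely, so both endpoint maps are
  -- injective.
  refine le_min (Finset.card_le_card_of_injOn (fun d => d.fst) ?_ ?_)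
    (Finset.card_le_card_of_injOn (fun d => d.snd) ?_ ?_)
  · intro d hd
    simp only [Finset.coe_filter, Finset.mem_univ, true_and, Set.mem_ofPred_eq] at hd
    exact hd.2.1
  · intro d hd d' hd' he
    simp only [Finset.coe_filter, Finset.mem_univ, true_and, Set.mem_ofPred_eq] at hd hd'
    refine SimpleGraph.Dart.ext _ _ (Prod.ext he (hM d.fst _ _ hd.1 ?_))
    exact (show d.fst = d'.fst from he) ▸ hd'.1
  · intro d hd
    simp only [Finset.coe_filter, Finset.mem_univ, true_and, Set.mem_ofPred_eq] at hd
    simpa using hd.2.2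
  · intro d hd d' hd' he
    simp only [Finset.coe_filter, Finset.mem_univ, true_and, Set.mem_ofPred_eq] at hd hd'
    refine SimpleGraph.Dart.ext _ _ (Prod.ext (hM d.snd _ _ hd.1.symm ?_) he)
    exact (show d.snd = d'.snd from he) ▸ hd'.1.symm

/-- The number of directed static links leaving a set of nodes. -/
def staticCut (I : Instance) (C : Finset (Fin I.n)) : ℕ :=
  (Finset.univ.filter fun p : Fin I.m × Bool =>
    I.src (Sum.inl p) ∈ C ∧ I.dst (Sum.inl p) ∉ C).card

/-- The bound does not depend on the matching, which is what makes a cut a certificate against all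
reconfigurations at once. -/
theorem card_present_leaving_le {M : SimpleGraph (Fin I.n)} (hM : I.IsReconfiguration M)
    (C : Finset (Fin I.n)) [DecidablePred (I.Present M)] :
    (Finset.univ.filter fun e => I.Present M e ∧ I.src e ∈ C ∧ I.dst e ∉ C).card ≤
      I.staticCut C + min C.card Cᶜ.card := by
  classical
  rw [Finset.card_filter, Fintype.sum_sum_type, ← Finset.card_filter, ← Finset.card_filter]
  refine Nat.add_le_add (le_of_eq ?_) (le_trans (le_of_eq ?_) (card_leaving_le hM C))
  · simp [staticCut, Present]
  · simp only [src, dst, Present]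
    congr

/-- A cut bounds the maximum load of every splittable flow from below. -/
theorem le_maxLoad_of_cut (h : I.IsCommodity s t a) {M : SimpleGraph (Fin I.n)}
    (hM : I.IsReconfiguration M) {f : I.Flow} (hf : I.ServesSplittable M f)
    {C : Finset (Fin I.n)} (hs : s ∈ C) (ht : t ∉ C) {k : ℕ}
    (hk : I.staticCut C + min C.card Cᶜ.card ≤ k) :
    (((I.demand s t : ℝ≥0) / k : ℝ≥0) : ℝ≥0∞) / ((a : ℝ≥0) : ℝ≥0∞) ≤ I.maxLoad M f := by
  classical
  have hk0 : 0 < k := by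
    have h1 : 0 < C.card := Finset.card_pos.2 ⟨s, hs⟩
    have h2 : 0 < Cᶜ.card := Finset.card_pos.2 ⟨t, by simpa using ht⟩
    have := lt_min h1 h2
    omega
  obtain ⟨hpres, hcons⟩ := hf s t
  set g := f s t with hg
  set L := Finset.univ.filter fun e => I.Present M e ∧ I.src e ∈ C ∧ I.dst e ∉ C with hL
  -- Conservation summed over `C`: only the demand at the source survives, because `t` lies outside.
  have hsum := Finset.sum_congr (rfl : C = C) fun v _ => hcons v
  rw [Finset.sum_add_distrib, Finset.sum_add_distrib, Finset.sum_ite_eq' C t,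
    Finset.sum_ite_eq' C s, if_neg ht, if_pos hs, add_zero] at hsum
  have hfib : ∀ φ : Link I.n I.m → Fin I.n, ∑ v ∈ C, ∑ e with φ e = v, g e =
      ∑ e with φ e ∈ C, g e := by
    intro φ
    rw [Finset.sum_filter, Finset.sum_congr rfl fun v _ => Finset.sum_filter _ _,
      Finset.sum_comm]
    simp
  rw [hfib, hfib] at hsum
  have hout : ∑ e with I.src e ∈ C, g e ≤ ∑ e with I.dst e ∈ C, g e + ∑ e ∈ L, g e := by
    rw [hL, Finset.sum_filter, Finset.sum_filter, Finset.sum_filter, ← Finset.sum_add_distrib]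
    refine Finset.sum_le_sum fun e _ => ?_
    by_cases hp : I.Present M e
    · by_cases h1 : I.src e ∈ C <;> by_cases h2 : I.dst e ∈ C <;> simp [h1, h2, hp]
    · simp [hpres e hp]
  have hd : (I.demand s t : ℝ≥0) ≤ ∑ e ∈ L, g e := by
    rw [hsum] at hout
    exact le_of_add_le_add_left hout
  -- Otherwise each of the at most `k` links in `L` carries less than a `k`-th of the demand that
  -- has to leave `C`.
  by_contra hlt
  rw [not_le] at hlt
  have hbound : ∀ e ∈ L, g e < (I.demand s t : ℝ≥0) / k := by
    intro e he
    have h1 := ((h.le_load f e).trans (load_le_maxLoad f (Finset.mem_filter.1 he).2.1)).trans_lt hlt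
    have ha : ((a : ℝ≥0) : ℝ≥0∞) ≠ 0 := by
      have := h.cap_pos.ne'
      simpa using this
    rw [ENNReal.div_lt_div_iff_left ha ENNReal.coe_ne_top] at h1
    exact_mod_cast h1
  have hcard : L.card ≤ k := (card_present_leaving_le hM C).trans hk
  have hdpos : (0 : ℝ≥0) < I.demand s t := by exact_mod_cast h.pos
  have hkpos : (0 : ℝ≥0) < k := by exact_mod_cast hk0
  rcases L.eq_empty_or_nonempty with h0 | hne
  · rw [h0, Finset.sum_empty] at hd
    exact absurd hd (not_le.2 hdpos)
  · have h1 := Finset.sum_lt_sum_of_nonempty hne hbound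
    rw [Finset.sum_const, nsmul_eq_mul] at h1
    have h2 : (L.card : ℝ≥0) * ((I.demand s t : ℝ≥0) / k) ≤ k * ((I.demand s t : ℝ≥0) / k) := by
      gcongr
    rw [mul_div_cancel₀ _ hkpos.ne'] at h2
    exact absurd (hd.trans_lt (h1.trans_le h2)) (lt_irrefl _)

/-- An integral flow of value `k` over the static links and a matching oriented from `A` to `B`,
together with a cut of size at most `k`, certifies an optimal matching. -/
theorem isSolution_of_flow_of_cut (h : I.IsCommodity s t a) {M : SimpleGraph (Fin I.n)}
    (hM : I.IsReconfiguration M) (A B : Finset (Fin I.n)) (hAB : Disjoint A B)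
    (hMAB : ∀ u v, M.Adj u v → (u ∈ A ∧ v ∈ B) ∨ (u ∈ B ∧ v ∈ A))
    (hcover : ∀ u ∈ A ∪ B, ∃ v, M.Adj u v)
    (x : Fin I.m × Bool → ℕ) (hx : ∀ p, x p ≤ 1) (k : ℕ)
    (hflow : ∀ v,
      (∑ p with I.src (Sum.inl p) = v, x p) + (if v ∈ A then 1 else 0) + (if v = t then k else 0) =
      (∑ p with I.dst (Sum.inl p) = v, x p) + (if v ∈ B then 1 else 0) + (if v = s then k else 0))
    {C : Finset (Fin I.n)} (hs : s ∈ C) (ht : t ∉ C)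
    (hk : I.staticCut C + min C.card Cᶜ.card ≤ k) : I.IsSolution Routing.SN M := by
  classical
  have hk0 : 0 < k := by
    have h1 : 0 < C.card := Finset.card_pos.2 ⟨s, hs⟩
    have h2 : 0 < Cᶜ.card := Finset.card_pos.2 ⟨t, by simpa using ht⟩
    have := lt_min h1 h2
    omega
  have hkpos : (0 : ℝ≥0) < k := by exact_mod_cast hk0
  -- A link of `M` is used only in the direction from `A` to `B`.
  let y : Link I.n I.m → ℕ := Sum.elim x fun d => if M.Adj d.fst d.snd ∧ d.fst ∈ A then 1 else 0
  have hy : ∀ e, y e ≤ 1 := by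
    rintro (p | d)
    · exact hx p
    · simp only [y, Sum.elim_inr]
      split_ifs <;> simp
  have hdart_src : ∀ v, (∑ d : (⊤ : SimpleGraph (Fin I.n)).Dart with d.fst = v, y (Sum.inr d)) =
      if v ∈ A then 1 else 0 := by
    intro v
    split_ifs with hv
    · obtain ⟨w, hw⟩ := hcover v (Finset.mem_union_left _ hv)
      rw [Finset.sum_eq_single (⟨(v, w), by simpa using hw.ne⟩ : (⊤ : SimpleGraph (Fin I.n)).Dart)]
      · simp [y, hw, hv]
      · rintro d hd hne
        have hd' : d.fst = v := (Finset.mem_filter.1 hd).2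
        refine if_neg fun hh => hne (SimpleGraph.Dart.ext _ _ (Prod.ext hd' ?_))
        exact hM v _ _ (hd' ▸ hh.1) hw
      · intro hn
        simp at hn
    · refine Finset.sum_eq_zero fun d hd => if_neg fun hh => hv ?_
      have hd' : d.fst = v := (Finset.mem_filter.1 hd).2
      exact hd' ▸ hh.2
  have hdart_dst : ∀ v, (∑ d : (⊤ : SimpleGraph (Fin I.n)).Dart with d.snd = v, y (Sum.inr d)) =
      if v ∈ B then 1 else 0 := by
    intro v
    split_ifs with hv
    · obtain ⟨w, hw⟩ := hcover v (Finset.mem_union_right _ hv)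
      have hwA : w ∈ A := by
        rcases hMAB v w hw with h1 | h1
        · exact absurd hv (Finset.disjoint_left.1 hAB h1.1)
        · exact h1.2
      rw [Finset.sum_eq_single (⟨(w, v), by simpa using hw.ne'⟩ : (⊤ : SimpleGraph (Fin I.n)).Dart)]
      · simp [y, hw.symm, hwA]
      · rintro d hd hne
        have hd' : d.snd = v := (Finset.mem_filter.1 hd).2
        refine if_neg fun hh => hne (SimpleGraph.Dart.ext _ _ (Prod.ext ?_ hd'))
        exact hM v _ _ (hd' ▸ hh.1.symm) hw
      · intro hn
        simp at hn
    · refine Finset.sum_eq_zero fun d hd => if_neg fun hh => hv ?_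
      have hd' : d.snd = v := (Finset.mem_filter.1 hd).2
      rcases hMAB _ _ hh.1 with h1 | h1
      · exact hd' ▸ h1.2
      · exact absurd h1.1 (Finset.disjoint_left.1 hAB hh.2)
  have hbal : ∀ v, (∑ e with I.src e = v, y e) + (if v = t then k else 0) =
      (∑ e with I.dst e = v, y e) + (if v = s then k else 0) := by
    intro v
    have hsplit : ∀ φ : Link I.n I.m → Fin I.n, (∑ e with φ e = v, y e) =
        (∑ p with φ (Sum.inl p) = v, x p) + ∑ d with φ (Sum.inr d) = v, y (Sum.inr d) := by
      intro φ
      rw [Finset.sum_filter, Fintype.sum_sum_type, ← Finset.sum_filter, ← Finset.sum_filter]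
      rfl
    rw [hsplit, hsplit]
    have h1 : (∑ d with I.src (Sum.inr d) = v, y (Sum.inr d)) = if v ∈ A then 1 else 0 := hdart_src v
    have h2 : (∑ d with I.dst (Sum.inr d) = v, y (Sum.inr d)) = if v ∈ B then 1 else 0 := hdart_dst v
    rw [h1, h2]
    exact hflow v
  -- Scaling the integral flow of value `k` to the demand puts at most `q` on each link, exactly the
  -- bound given by the cut.
  let q : ℝ≥0 := (I.demand s t : ℝ≥0) / k
  have hqk : q * k = I.demand s t := div_mul_cancel₀ _ hkpos.ne'
  let f : I.Flow := fun i j e => if (i, j) = (s, t) then q * (y e : ℝ≥0) else 0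
  refine isSolution_of_le hM (f := f) ?_ ((q : ℝ≥0∞) / ((a : ℝ≥0) : ℝ≥0∞)) ?_ ?_
  · intro i j
    by_cases hij : (i, j) = (s, t)
    · simp only [Prod.mk.injEq] at hij
      obtain ⟨rfl, rfl⟩ := hij
      simp only [f, if_true]
      refine ⟨?_, fun v => ?_⟩
      · rintro (p | d) hp
        · exact (hp trivial).elim
        · have : y (Sum.inr d) = 0 := if_neg fun hh => hp hh.1
          rw [this]
          simp
      · have := congrArg (fun z : ℕ => q * (z : ℝ≥0)) (hbal v)
        simp only [Nat.cast_add, mul_add, Nat.cast_sum, Finset.mul_sum, Nat.cast_ite,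
          mul_ite, hqk, Nat.cast_zero, mul_zero] at this
        exact this
    · have hf0 : ∀ e, f i j e = 0 := fun e => if_neg hij
      simp [hf0, h.zero i j hij]
  · refine iSup₂_le fun e _ => h.load_le e ?_ fun i j hij => if_neg hij
    simp only [f, if_true]
    have : (y e : ℝ≥0) ≤ 1 := by exact_mod_cast hy e
    exact mul_le_of_le_one_right zero_le this
  · intro M' f' hM' hf'
    exact le_maxLoad_of_cut h hM' hf' hs ht hk

end MCRN.Instance

namespace MCRN

/-! ### Flows as reorientations -/

/-- Outdegree minus indegree of `v` in the digraph with arcs `S i → D i`, `i < N`. -/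
def degDiff (N : ℕ) (S D : ℕ → ℕ) (v : ℕ) : ℤ :=
  ∑ i ∈ Finset.range N, ((if S i = v then 1 else 0) - (if D i = v then 1 else 0))

/-- The digraph `(S, D)` arises from `(S₀, D₀)` by reversing the arcs of a flow of value `k` from `s`
to `t`. -/
structure ReversesFlow (N : ℕ) (S₀ D₀ S D : ℕ → ℕ) (s t k : ℕ) : Prop where
  reoriented : ∀ i < N, (S i = S₀ i ∧ D i = D₀ i) ∨ (S i = D₀ i ∧ D i = S₀ i)
  degDiff_eq : ∀ v, degDiff N S D v = 
    (if v = t then 2 * (k : ℤ) else 0) - (if v = s then 2 * (k : ℤ) else 0)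

/-- The flow whose arcs are reversed. -/
def reversed (S₀ S : ℕ → ℕ) (i : ℕ) : ℕ := if S i = S₀ i then 0 else 1

theorem degDiff_update {N : ℕ} {S D : ℕ → ℕ} {i : ℕ} (hi : i < N) (v : ℕ) :
    degDiff N (Function.update S i (D i)) (Function.update D i (S i)) v =
      degDiff N S D v + (if v = D i then 2 else 0) - (if v = S i then 2 else 0) := by
  have hi' := Finset.mem_range.2 hi
  rw [degDiff, degDiff, ← Finset.add_sum_erase _ _ hi', ← Finset.add_sum_erase _ _ hi',
    Finset.sum_congr rfl (g := fun j => ((if S j = v then 1 else 0) - (if D j = v then 1 else 0)))]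
  · simp only [Function.update_self]
    grind
  · intro j hj
    simp [Function.update_of_ne (Finset.ne_of_mem_erase hj)]

namespace ReversesFlow

variable {N s t k : ℕ} {S₀ D₀ S D : ℕ → ℕ}

/-- The degree difference at `s` is -2k, while each of the `N` arcs contributes at least -1. This
bounds the number of augmentations. -/
theorem two_mul_le (h : ReversesFlow N S₀ D₀ S D s t k) (hst : s ≠ t) : 2 * k ≤ N := by
  have h1 := h.degDiff_eq s
  rw [if_neg hst, if_pos rfl] at h1
  have h2 : -(N : ℤ) ≤ degDiff N S D s := by
    calc -(N : ℤ) = ∑ i ∈ Finset.range N, (-1 : ℤ) := by simp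
      _ ≤ _ := Finset.sum_le_sum fun i _ => by split_ifs <;> simp
  omega

/-- Reversing an arc lowers the degree difference of its tail by 2 and raises that of its head by 2.
In a balanced digraph the new degree differences are therefore -2 times the net outflow of the
reversed arcs. -/
theorem conservation (h : ReversesFlow N S₀ D₀ S D s t k) (h0 : ∀ v, degDiff N S₀ D₀ v = 0)
    (v : ℕ) :
    ∑ i ∈ Finset.range N, (reversed S₀ S i : ℤ) *
      ((if S₀ i = v then 1 else 0) - (if D₀ i = v then 1 else 0)) =
    (if v = s then (k : ℤ) else 0) - (if v = t then (k : ℤ) else 0) := by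
  have h1 : degDiff N S D v = degDiff N S₀ D₀ v - 2 * ∑ i ∈ Finset.range N,
      (reversed S₀ S i : ℤ) * ((if S₀ i = v then 1 else 0) - (if D₀ i = v then 1 else 0)) := by
    rw [degDiff, degDiff, Finset.mul_sum, ← Finset.sum_sub_distrib]
    refine Finset.sum_congr rfl fun i hi => ?_
    have := h.reoriented i (Finset.mem_range.1 hi)
    unfold reversed
    grind
  rw [h0, h.degDiff_eq v] at h1
  grind

/-- Weak duality with equality: if no arc of the reoriented digraph leaves `C`, then at most `k` arcs
of the original one do. -/
theorem cut_le (h : ReversesFlow N S₀ D₀ S D s t k) (h0 : ∀ v, degDiff N S₀ D₀ v = 0)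
    {C : Finset ℕ} (hs : s ∈ C) (ht : t ∉ C) (hC : ∀ i < N, S i ∈ C → D i ∈ C) :
    ∑ i ∈ Finset.range N, (if S₀ i ∈ C ∧ D₀ i ∉ C then 1 else 0) ≤ k := by
  have h1 := Finset.sum_congr (rfl : C = C) fun v _ => h.conservation h0 v
  rw [Finset.sum_sub_distrib, Finset.sum_ite_eq' C s, Finset.sum_ite_eq' C t, if_pos hs, if_neg ht,
    sub_zero, Finset.sum_comm] at h1
  zify
  rw [← h1]
  -- Termwise: by `hC` an original arc leaving `C` must have been reversed and counts 1, and an arc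
  -- entering `C` cannot have been reversed, so it does not count -1.
  refine Finset.sum_le_sum fun i hi => ?_
  rw [← Finset.mul_sum, Finset.sum_sub_distrib, Finset.sum_ite_eq C, Finset.sum_ite_eq C]
  have h2 := h.reoriented i (Finset.mem_range.1 hi)
  have h3 := hC i (Finset.mem_range.1 hi)
  unfold reversed
  grind

end ReversesFlow

/-! ### The network with hub and the matching obtained from its flow -/

/-- The static links in both directions, and arcs between each node and an additional node `n`. -/
structure Instance.HubNetwork (I : Instance) (S D : ℕ → ℕ) : Prop where
  static : ∀ e : Fin I.m, S e = (I.ends e).1 ∧ D e = (I.ends e).2 ∧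
    S (I.m + e) = (I.ends e).2 ∧ D (I.m + e) = (I.ends e).1
  hub : ∀ v < I.n, S (I.m + I.m + v) = v ∧ D (I.m + I.m + v) = I.n ∧
    S (I.m + I.m + I.n + v) = I.n ∧ D (I.m + I.m + I.n + v) = v

/-- The arcs are numbered in four blocks; the regrouping puts each arc next to its opposite. -/
theorem sum_range_hub {R : Type*} [AddCommMonoid R] (m n : ℕ) (F : ℕ → R) :
    ∑ i ∈ Finset.range (m + m + n + n), F i =
      (∑ e : Fin m, (F e + F (m + e))) + ∑ v : Fin n, (F (m + m + v) + F (m + m + n + v)) := by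
  rw [Finset.sum_range_add, Finset.sum_range_add, Finset.sum_range_add, Finset.sum_add_distrib,
    Finset.sum_add_distrib, Finset.sum_range, Finset.sum_range, Finset.sum_range, Finset.sum_range,
    add_assoc (_ + _)]

namespace Instance.HubNetwork

variable {I : Instance} {S₀ D₀ S D : ℕ → ℕ} {k : ℕ} {s t : Fin I.n} {a : ℚ≥0}

/-- Opposite arcs cancel; this balance is what lets degree differences measure a flow. -/
theorem degDiff_eq_zero (h : I.HubNetwork S₀ D₀) (v : ℕ) :
    degDiff (I.m + I.m + I.n + I.n) S₀ D₀ v = 0 := by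
  rw [degDiff, sum_range_hub, Finset.sum_eq_zero, Finset.sum_eq_zero, add_zero]
  · intro u _
    obtain ⟨h1, h2, h3, h4⟩ := h.hub u u.2
    rw [h1, h2, h3, h4]
    ring
  · intro e _
    obtain ⟨h1, h2, h3, h4⟩ := h.static e
    rw [h1, h2, h3, h4]
    ring

/-- The nodes that send a unit of flow to the hub, in terms of the tails of the reoriented arcs. -/
def sender (m n : ℕ) (S : ℕ → ℕ) (u : ℕ) : Prop := S (m + m + u) = n ∧ S (m + m + n + u) = n

/-- The nodes that receive a unit of flow from the hub. -/
def receiver (m n : ℕ) (S : ℕ → ℕ) (u : ℕ) : Prop := S (m + m + u) = u ∧ S (m + m + n + u) = u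

instance (m n : ℕ) (S : ℕ → ℕ) : DecidablePred (sender m n S) := fun _ => instDecidableAnd

instance (m n : ℕ) (S : ℕ → ℕ) : DecidablePred (receiver m n S) := fun _ => instDecidableAnd

/-- If both hub arcs of `v` or neither of them carry flow, the exchange with the hub cancels and `v`
is neither sender nor receiver. -/
theorem reversed_sub (h : I.HubNetwork S₀ D₀)
    (hr : ReversesFlow (I.m + I.m + I.n + I.n) S₀ D₀ S D s t k) {v : ℕ} (hv : v < I.n) :
    (reversed S₀ S (I.m + I.m + v) : ℤ) - reversed S₀ S (I.m + I.m + I.n + v) =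
      (if sender I.m I.n S v then 1 else 0) - (if receiver I.m I.n S v then 1 else 0) := by
  obtain ⟨h1, h2, h3, h4⟩ := h.hub v hv
  have h5 := hr.reoriented (I.m + I.m + v) (by omega)
  have h6 := hr.reoriented (I.m + I.m + I.n + v) (by omega)
  unfold reversed sender receiver
  grind

/-- This is conservation at the hub, which is neither source nor sink. -/
theorem card_sender_eq (h : I.HubNetwork S₀ D₀)
    (hr : ReversesFlow (I.m + I.m + I.n + I.n) S₀ D₀ S D s t k) :
    ((Finset.range I.n).filter (sender I.m I.n S)).card =
      ((Finset.range I.n).filter (receiver I.m I.n S)).card := by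
  have h1 := hr.conservation h.degDiff_eq_zero I.n
  rw [if_neg s.2.ne', if_neg t.2.ne', sub_zero, sum_range_hub, Finset.sum_eq_zero, zero_add] at h1
  · rw [Finset.card_filter, Finset.card_filter]
    zify
    rw [← sub_eq_zero, ← Finset.sum_sub_distrib, Finset.sum_range, ← neg_eq_zero,
      ← Finset.sum_neg_distrib]
    refine Eq.trans (Finset.sum_congr rfl fun v _ => ?_) h1
    obtain ⟨h3, h4, h5, h6⟩ := h.hub v v.2
    rw [← h.reversed_sub hr v.2, h3, h4, h5, h6, if_pos rfl, if_neg v.2.ne]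
    ring
  · intro e _
    obtain ⟨h3, h4, h5, h6⟩ := h.static e
    rw [h3, h4, h5, h6]
    simp [(I.ends e).1.2.ne, (I.ends e).2.2.ne]

/-- The hub arcs are eliminated in favour of the indicators of senders and receivers, giving the
balance required by `isSolution_of_flow_of_cut`. -/
theorem conservation (h : I.HubNetwork S₀ D₀)
    (hr : ReversesFlow (I.m + I.m + I.n + I.n) S₀ D₀ S D s t k) (v : Fin I.n) :
    (∑ p with I.src (Sum.inl p) = v, reversed S₀ S (if p.2 then I.m + p.1 else p.1)) +
      (if sender I.m I.n S v then 1 else 0) + (if v = t then k else 0) =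
    (∑ p with I.dst (Sum.inl p) = v, reversed S₀ S (if p.2 then I.m + p.1 else p.1)) +
      (if receiver I.m I.n S v then 1 else 0) + (if v = s then k else 0) := by
  have h1 := hr.conservation h.degDiff_eq_zero v
  rw [sum_range_hub] at h1
  have h2 : ∀ u : Fin I.n, (reversed S₀ S (I.m + I.m + u) : ℤ) *
      ((if S₀ (I.m + I.m + u) = v then 1 else 0) - (if D₀ (I.m + I.m + u) = v then 1 else 0)) +
      (reversed S₀ S (I.m + I.m + I.n + u) : ℤ) * ((if S₀ (I.m + I.m + I.n + u) = v then 1 else 0) -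
        (if D₀ (I.m + I.m + I.n + u) = v then 1 else 0)) =
      if u = v then (if sender I.m I.n S v then 1 else 0) - (if receiver I.m I.n S v then 1 else 0)
      else 0 := by
    intro u
    obtain ⟨h3, h4, h5, h6⟩ := h.hub u u.2
    rw [h3, h4, h5, h6, if_neg v.2.ne', ← h.reversed_sub hr v.2]
    simp only [Fin.val_inj]
    split_ifs with huv
    · subst huv
      ring
    · ring
  rw [Finset.sum_congr rfl fun u _ => h2 u, Finset.sum_ite_eq' Finset.univ v,
    if_pos (Finset.mem_univ v)] at h1
  have h7 : ∑ e : Fin I.m, ((reversed S₀ S e : ℤ) *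
      ((if S₀ e = v then 1 else 0) - (if D₀ e = v then 1 else 0)) +
      (reversed S₀ S (I.m + e) : ℤ) * ((if S₀ (I.m + e) = v then 1 else 0) -
        (if D₀ (I.m + e) = v then 1 else 0))) =
      ((∑ p with I.src (Sum.inl p) = v, reversed S₀ S (if p.2 then I.m + p.1 else p.1) : ℕ) : ℤ) -
      ((∑ p with I.dst (Sum.inl p) = v, reversed S₀ S (if p.2 then I.m + p.1 else p.1) : ℕ) : ℤ) := by
    rw [Finset.sum_filter, Finset.sum_filter, Fintype.sum_prod_type, Fintype.sum_prod_type]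
    push_cast
    rw [← Finset.sum_sub_distrib]
    refine Finset.sum_congr rfl fun e _ => ?_
    obtain ⟨h3, h4, h5, h6⟩ := h.static e
    rw [h3, h4, h5, h6]
    simp only [Fintype.sum_bool, src, dst, Fin.val_inj, if_true, Bool.false_eq_true, if_false]
    split_ifs <;> push_cast <;> ring
  rw [h7] at h1
  simp only [Fin.val_inj] at h1
  zify
  push_cast at h1
  linarith

theorem endpoints_le (h : I.HubNetwork S₀ D₀) {i : ℕ} (hi : i < I.m + I.m + I.n + I.n) :
    S₀ i ≤ I.n ∧ D₀ i ≤ I.n := by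
  by_cases h1 : i < I.m
  · obtain ⟨h3, h4, -⟩ := h.static ⟨i, h1⟩
    simp only at h3 h4
    omega
  by_cases h2 : i < I.m + I.m
  · obtain ⟨-, -, h3, h4⟩ := h.static ⟨i - I.m, by omega⟩
    simp only [show I.m + (i - I.m) = i by omega] at h3 h4
    omega
  by_cases h5 : i < I.m + I.m + I.n
  · obtain ⟨h3, h4, -⟩ := h.hub (i - (I.m + I.m)) (by omega)
    simp only [show I.m + I.m + (i - (I.m + I.m)) = i by omega] at h3 h4
    omega
  · obtain ⟨-, -, h3, h4⟩ := h.hub (i - (I.m + I.m + I.n)) (by omega)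
    simp only [show I.m + I.m + I.n + (i - (I.m + I.m + I.n)) = i by omega] at h3 h4
    omega

/-- If the hub belongs to `C`, the hub arcs leaving `C` lead to the nodes outside; if not, they
start at the nodes inside. In either case their number is at least the minimum. -/
theorem cut_le (h : I.HubNetwork S₀ D₀)
    (hr : ReversesFlow (I.m + I.m + I.n + I.n) S₀ D₀ S D s t k)
    {C : ℕ → Prop} [DecidablePred C] (hs : C s) (ht : ¬ C t)
    (hC : ∀ i < I.m + I.m + I.n + I.n, C (S i) → C (D i)) :
    I.staticCut (Finset.univ.filter fun u : Fin I.n => C u) +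
      min (Finset.univ.filter fun u : Fin I.n => C u).card
        (Finset.univ.filter fun u : Fin I.n => C u)ᶜ.card ≤ k := by
  set C' := (Finset.range (I.n + 1)).filter C with hC'
  have hmem : ∀ v ≤ I.n, v ∈ C' ↔ C v := by
    intro v hv
    simp only [hC', Finset.mem_filter, Finset.mem_range]
    exact and_iff_right (by omega)
  have hcut := hr.cut_le (C := C') h.degDiff_eq_zero ((hmem s s.2.le).2 hs)
    (fun hh => ht ((hmem t t.2.le).1 hh)) (by
      intro i hi hSi
      have h1 := hr.reoriented i hi
      have h2 := h.endpoints_le hi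
      rw [hmem _ (by omega)] at hSi ⊢
      exact hC i hi hSi)
  rw [sum_range_hub] at hcut
  refine le_trans (Nat.add_le_add (le_of_eq ?_) ?_) hcut
  · rw [staticCut, Finset.card_filter, Fintype.sum_prod_type]
    refine Finset.sum_congr rfl fun e _ => ?_
    obtain ⟨h3, h4, h5, h6⟩ := h.static e
    rw [h3, h4, h5, h6, Fintype.sum_bool, add_comm]
    simp only [hmem _ (I.ends e).1.2.le, hmem _ (I.ends e).2.2.le, src, dst, Finset.mem_filter,
      Finset.mem_univ, true_and]
  · have hval : ∀ v : Fin I.n,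
        (if S₀ (I.m + I.m + v) ∈ C' ∧ D₀ (I.m + I.m + v) ∉ C' then 1 else 0) +
        (if S₀ (I.m + I.m + I.n + v) ∈ C' ∧ D₀ (I.m + I.m + I.n + v) ∉ C' then 1 else 0) =
        if C I.n then (if ¬ C v then 1 else 0) else (if C v then 1 else 0) := by
      intro v
      obtain ⟨h3, h4, h5, h6⟩ := h.hub v v.2
      rw [h3, h4, h5, h6]
      simp only [hmem _ v.2.le, hmem _ le_rfl]
      by_cases h7 : C I.n <;> by_cases h8 : C v <;> simp [h7, h8]
    rw [Finset.sum_congr rfl fun v _ => hval v]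
    by_cases hn : C I.n
    · simp only [hn, if_true]
      refine (min_le_right _ _).trans (le_of_eq ?_)
      rw [Finset.compl_filter, Finset.card_filter]
    · simp only [hn, if_false]
      refine (min_le_left _ _).trans (le_of_eq ?_)
      rw [Finset.card_filter]

/-- A maximum flow in the network with hub yields an optimal matching: join the senders to the
receivers. -/
theorem isSolution (h : I.HubNetwork S₀ D₀) (hc : I.IsCommodity s t a)
    (hr : ReversesFlow (I.m + I.m + I.n + I.n) S₀ D₀ S D s t k)
    {C : ℕ → Prop} (hs : C s) (ht : ¬ C t) (hC : ∀ i < I.m + I.m + I.n + I.n, C (S i) → C (D i))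
    {M : SimpleGraph (Fin I.n)} (hM : I.IsReconfiguration M)
    (hadj : ∀ u v : Fin I.n, M.Adj u v → (sender I.m I.n S u ∧ receiver I.m I.n S v) ∨
      (receiver I.m I.n S u ∧ sender I.m I.n S v))
    (hcover : ∀ u : Fin I.n, sender I.m I.n S u ∨ receiver I.m I.n S u → ∃ v, M.Adj u v) :
    I.IsSolution Routing.SN M := by
  classical
  refine isSolution_of_flow_of_cut hc hM
    (Finset.univ.filter fun u : Fin I.n => sender I.m I.n S u)
    (Finset.univ.filter fun u : Fin I.n => receiver I.m I.n S u) ?_ ?_ ?_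
    (fun p => reversed S₀ S (if p.2 then I.m + p.1 else p.1)) ?_ k ?_
    (C := Finset.univ.filter fun u : Fin I.n => C u) (by simpa using hs) (by simpa using ht) ?_
  · rw [Finset.disjoint_left]
    intro u hu hu'
    have h1 := (Finset.mem_filter.1 hu).2.1
    have h2 := (Finset.mem_filter.1 hu').2.1
    exact u.2.ne (h2.symm.trans h1)
  · simpa using hadj
  · simpa using hcover
  · intro p
    simp only [reversed]
    split_ifs <;> simp
  · simpa only [Finset.mem_filter, Finset.mem_univ, true_and] using h.conservation hr
  · have hcut := h.cut_le hr hs ht hC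
    convert hcut

end Instance.HubNetwork

end MCRN

namespace MCRN

/-! ### Reading the input -/

theorem length_flatMap_const {α : Type*} (l : List α) (f : α → List ℕ) {c : ℕ}
    (hf : ∀ x, (f x).length = c) : (l.flatMap f).length = l.length * c := by
  simp [List.length_flatMap, hf]

theorem getD_flatMap_const {α : Type*} (l : List α) (f : α → List ℕ) {c : ℕ}
    (hf : ∀ x, (f x).length = c) {i r : ℕ} (hi : i < l.length) (hr : r < c) :
    (l.flatMap f).getD (c * i + r) 0 = (f l[i]).getD r 0 := by
  induction l generalizing i with
  | nil => simp at hi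
  | cons x l ih =>
    rw [List.flatMap_cons]
    cases i with
    | zero => rw [Nat.mul_zero, Nat.zero_add, List.getD_append _ _ _ _ (by rw [hf]; exact hr)]; rfl
    | succ i =>
      rw [List.getD_append_right _ _ _ _ (by rw [hf]; nlinarith), hf,
        show c * (i + 1) + r - c = c * i + r by rw [Nat.mul_succ]; omega,
        ih (by simpa using hi)]
      rfl

namespace Instance

variable (I : Instance)

theorem length_encodeTable {n : ℕ} (A : Fin n → Fin n → ℚ≥0) :
    (encodeTable A).length = n * (n * 2) := by
  rw [encodeTable, length_flatMap_const (c := n * 2), List.length_finRange]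
  intro i
  rw [length_flatMap_const (c := 2), List.length_finRange]
  exact fun j => rfl

theorem getD_encodeTable {n : ℕ} (A : Fin n → Fin n → ℚ≥0) (i j : Fin n) :
    (encodeTable A).getD (2 * (n * i + j)) 0 = (A i j).num := by
  have hj := j.2
  have h1 := getD_flatMap_const (List.finRange n)
    (fun i => (List.finRange n).flatMap fun j => encodeRat (A i j)) (c := n * 2)
    (fun i => by rw [length_flatMap_const (c := 2), List.length_finRange]; exact fun j => rfl)
    (i := i) (r := 2 * j + 0) (by simp) (by omega)
  rw [getD_flatMap_const _ _ (c := 2) (fun j => rfl) (by simp) (by omega)] at h1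
  rw [encodeTable, show 2 * (n * i + j) = n * 2 * i + (2 * j + 0) by ring, h1]
  simp [encodeRat]

/-- `D` lists the input sequence of `I`, as far as the algorithms read it. -/
structure Reads (D : ℕ → ℕ) : Prop where
  n : D 0 = I.n
  m : D 1 = I.m
  ends : ∀ e : Fin I.m, D (2 + 6 * e) = (I.ends e).1 ∧ D (2 + 6 * e + 1) = (I.ends e).2
  demand : ∀ i j : Fin I.n,
    D (2 + 6 * I.m + 2 * I.n * I.n + 2 * (I.n * i + j)) = 0 ↔ I.demand i j = 0

theorem length_encode : I.encode.length = 2 + 6 * I.m + 2 * I.n * I.n + 2 * I.n * I.n := by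
  simp only [encode, List.length_append, length_encodeTable]
  rw [length_flatMap_const (c := 6)]
  · simp
    ring
  · exact fun e => rfl

theorem reads_encode : I.Reads fun i => I.encode.getD i 0 := by
  have hlen : ∀ e : Fin I.m, ([((I.ends e).1 : ℕ), ((I.ends e).2 : ℕ)] ++
      encodeRat (I.cap (Sum.inl (e, false))) ++ encodeRat (I.cap (Sum.inl (e, true)))).length = 6 :=
    fun e => rfl
  have hstatic : ∀ (e : Fin I.m) (r : ℕ), r < 6 → I.encode.getD (2 + 6 * e + r) 0 =
      ([((I.ends e).1 : ℕ), ((I.ends e).2 : ℕ)] ++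
      encodeRat (I.cap (Sum.inl (e, false))) ++ encodeRat (I.cap (Sum.inl (e, true)))).getD r 0 := by
    intro e r hr
    have he := e.2
    have hl := length_flatMap_const (List.finRange I.m) _ hlen
    rw [List.length_finRange] at hl
    rw [encode, List.getD_append, List.getD_append, List.getD_append_right]
    · simp only [List.length_cons, List.length_nil]
      rw [show 2 + 6 * (e : ℕ) + r - (0 + 1 + 1) = 6 * e + r by omega,
        getD_flatMap_const _ _ hlen (by simp) hr]
      simp
    · simp only [List.length_cons, List.length_nil]
      omega
    · rw [List.length_append, hl]
      simp only [List.length_cons, List.length_nil]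
      omega
    · rw [List.length_append, List.length_append, hl]
      simp only [List.length_cons, List.length_nil]
      omega
  refine ⟨rfl, rfl, fun e => ⟨hstatic e 0 (by omega), hstatic e 1 (by omega)⟩, fun i j => ?_⟩
  have hl := length_flatMap_const (List.finRange I.m) _ hlen
  rw [List.length_finRange] at hl
  have hlen' : ([I.n, I.m] ++ ((List.finRange I.m).flatMap fun e =>
      [((I.ends e).1 : ℕ), ((I.ends e).2 : ℕ)] ++
      encodeRat (I.cap (Sum.inl (e, false))) ++ encodeRat (I.cap (Sum.inl (e, true)))) ++
      encodeTable (fun i j => if h : i ≠ j then I.cap (Sum.inr ⟨(i, j), h⟩) else 0)).length =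
      2 + 6 * I.m + 2 * I.n * I.n := by
    rw [List.length_append, List.length_append, hl, length_encodeTable]
    simp only [List.length_cons, List.length_nil]
    ring
  show I.encode.getD _ 0 = 0 ↔ _
  rw [encode, List.getD_append_right _ _ _ _ (by rw [hlen']; omega), hlen', Nat.add_sub_cancel_left,
    getD_encodeTable]
  -- A nonnegative rational vanishes exactly when its numerator does, so the algorithms never read
  -- denominators.
  rw [← not_iff_not, ← ne_eq, ← ne_eq, ← pos_iff_ne_zero, ← pos_iff_ne_zero]
  exact NNRat.num_pos

theorem le_inputSize (w : List ℕ) : w.length ≤ inputSize w := by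
  rw [inputSize, ← List.length_map (fun x => Nat.size x + 1)]
  exact List.length_le_sum_of_one_le _ fun i hi => by
    obtain ⟨x, -, rfl⟩ := List.mem_map.1 hi
    omega

theorem n_le_inputSize : I.n ≤ inputSize I.encode := by
  have h1 := le_inputSize I.encode
  rw [length_encode] at h1
  nlinarith [Nat.zero_le I.n]

theorem m_le_inputSize : I.m ≤ inputSize I.encode := by
  have h1 := le_inputSize I.encode
  rw [length_encode] at h1
  omega

end Instance

/-! ### Finding the commodity -/

infixr:60 " ;; " => Program.seq

namespace Program

/-- The scalar stored in cell `0` of array `a`. -/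
abbrev var (a : ℕ) : Expr := Expr.read a (Expr.const 0)

/-- Assignment to a scalar. -/
abbrev set (a : ℕ) (x : Expr) : Program := write a (Expr.const 0) x

/-- The number of nodes in the input. -/
abbrev numNodes : Expr := Expr.read 0 (Expr.const 0)

/-- The number of static links in the input. -/
abbrev numLinks : Expr := Expr.read 0 (Expr.const 1)

open MCRN.Expr

/-- Store in scalar `2` the position of the demand table. -/
def seekDemand : Program :=
  set 2 (add (const 2) (add numLinks (add numLinks (add numLinks
    (add numLinks (add numLinks numLinks)))))) ;;
  loop (sub numNodes (var 5))
    (set 2 (add (var 2) (add numNodes numNodes)) ;; set 5 (add (var 5) (const 1)))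

/-- Scan the demand table for a positive entry, with row and column in scalars `3` and `4`. -/
def scanDemand : Program :=
  loop (sub (const 1) (read 0 (var 2)))
    (set 2 (add (var 2) (const 2)) ;; set 4 (add (var 4) (const 1)) ;;
      ite (sub numNodes (var 4)) skip (set 4 (const 0) ;; set 3 (add (var 3) (const 1))))

end Program

open Program

variable {I : Instance} {s t : Fin I.n} {a : ℚ≥0}

/-- Without a multiplication instruction, the length 2n² of the capacity table is accumulated by n
additions of 2n. -/
theorem seekDemand_halts {σ : Memory} (hD : I.Reads (σ 0)) (h5 : σ 5 0 = 0) :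
    Halts seekDemand σ (30 * (I.n + 3)) fun σ' =>
      σ' 2 0 = 2 + 6 * I.m + 2 * I.n * I.n := by
  refine Halts.seq (T := 40) (LoopFree.halts (by simp [LoopFree]) (by decide) rfl) (T' := 30 * (I.n + 1))
    (fun σ' h => Halts.loop 20 (fun r τ => τ 0 = σ 0 ∧
      τ 2 0 = 2 + 6 * I.m + 2 * I.n * τ 5 0 ∧ τ 5 0 ≤ I.n ∧ r = I.n - τ 5 0) (r := I.n)
      ?_ ?_ ?_ ?_) (by omega)
  · subst h
    simp [exec, Expr.eval, h5, hD.m]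
    ring
  · rintro r τ ⟨h0, h2, h5, rfl⟩ hb
    simp only [Expr.eval, h0, hD.n] at hb
    refine LoopFree.halts (by simp [LoopFree]) (by decide) ⟨I.n - (τ 5 0 + 1), by omega, ?_⟩
    simp [exec, Expr.eval, h0, h2, hD.n]
    refine ⟨by ring, by omega⟩
  · rintro r τ ⟨h0, h2, h5, rfl⟩ hb
    simp only [Expr.eval, h0, hD.n] at hb
    rw [h2, show τ 5 0 = I.n by omega]
  · simp only [Expr.cost]
    omega

/-- The scan has no test for the end of the table: it stops because a positive entry exists. The
variant is the distance to that entry, and uniqueness of the commodity identifies where it stops. -/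
theorem scanDemand_halts {σ : Memory} (hD : I.Reads (σ 0)) (hc : I.IsCommodity s t a)
    (h2 : σ 2 0 = 2 + 6 * I.m + 2 * I.n * I.n) (h3 : σ 3 0 = 0) (h4 : σ 4 0 = 0) :
    Halts scanDemand σ (40 * (I.n * I.n + I.n + 1)) fun σ' => σ' 3 0 = s ∧ σ' 4 0 = t := by
  have hs := s.2
  have ht := t.2
  have hn : 0 < I.n := by omega
  have hst : I.n * s + t < I.n * I.n := by nlinarith
  -- Up to the position of the commodity, the row index stays inside the table.
  have hkey : ∀ {i j : ℕ}, j < I.n → I.n * i + j ≤ I.n * s + t → i < I.n := by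
    intro i j hj h
    by_contra hi
    have : I.n * I.n ≤ I.n * i := Nat.mul_le_mul_left _ (not_lt.1 hi)
    omega
  refine Halts.loop 30 (fun r τ => τ 0 = σ 0 ∧
      τ 2 0 = 2 + 6 * I.m + 2 * I.n * I.n + 2 * (I.n * τ 3 0 + τ 4 0) ∧ τ 4 0 < I.n ∧
      I.n * τ 3 0 + τ 4 0 ≤ I.n * s + t ∧ r = I.n * s + t - (I.n * τ 3 0 + τ 4 0))
      (r := I.n * s + t) ⟨rfl, by simp [h2, h3, h4], by omega, by simp [h3, h4],
        by simp [h3, h4]⟩ ?_ ?_ ?_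
  · rintro r τ ⟨h0, h2, h4, hle, rfl⟩ hb
    have hi := hkey h4 hle
    have hzero := hD.demand ⟨τ 3 0, hi⟩ ⟨τ 4 0, h4⟩
    simp only at hzero
    simp only [Expr.eval, h0] at hb
    rw [← h2] at hzero
    have hlt : I.n * τ 3 0 + τ 4 0 < I.n * s + t := by
      refine lt_of_le_of_ne hle fun he => ?_
      have h5 : τ 3 0 = s := by
        have := congrArg (· / I.n) he
        simpa [Nat.mul_add_div hn, Nat.div_eq_of_lt h4, Nat.div_eq_of_lt ht] using this
      have h6 : τ 4 0 = t := by
        rw [h5] at he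
        omega
      have h7 := hzero.1 (by omega)
      simp only [h5, h6] at h7
      exact hc.pos.ne' h7
    refine LoopFree.halts (by simp [LoopFree]) (by decide)
      ⟨I.n * s + t - (I.n * τ 3 0 + τ 4 0 + 1), by omega, ?_⟩
    by_cases hj : τ 4 0 + 1 < I.n
    · have hj' : I.n - (τ 4 0 + 1) ≠ 0 := by omega
      simp [exec, Expr.eval, h0, hD.n, hj', h2]
      omega
    · have hj' : I.n - (τ 4 0 + 1) = 0 := by omega
      have he : I.n * (τ 3 0 + 1) = I.n * τ 3 0 + τ 4 0 + 1 := by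
        rw [Nat.mul_succ]
        omega
      simp [exec, Expr.eval, h0, hD.n, hj', h2, he]
      omega
  · rintro r τ ⟨h0, h2, h4, hle, rfl⟩ hb
    have hi := hkey h4 hle
    have hpos := hD.demand ⟨τ 3 0, hi⟩ ⟨τ 4 0, h4⟩
    simp only [Expr.eval, h0] at hb
    simp only at hpos
    rw [← h2] at hpos
    by_contra hne
    refine absurd (hpos.2 (hc.zero _ _ fun he => hne ?_)) (by omega)
    simp only [Prod.mk.injEq, Fin.ext_iff] at he
    exact he
  · simp only [Expr.cost]
    nlinarith

end MCRN

namespace MCRN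

/-! ### Building the network with hub -/

namespace Program

open MCRN.Expr

/-- Twice the number of static links. -/
abbrev numStatic : Expr := add numLinks numLinks

/-- The number of arcs of the network with hub. -/
abbrev numArcs : Expr := add (add numStatic numNodes) numNodes

/-- Store the tails and heads of the static arcs in arrays `7` and `8`. -/
def buildStatic : Program :=
  (set 5 (const 0) ;; set 6 (const 2)) ;;
  loop (sub numLinks (var 5))
    (write 7 (var 5) (read 0 (var 6)) ;; write 8 (var 5) (read 0 (add (var 6) (const 1))) ;;
      write 7 (add numLinks (var 5)) (read 0 (add (var 6) (const 1))) ;;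
      write 8 (add numLinks (var 5)) (read 0 (var 6)) ;;
      set 6 (add (var 6) (const 6)) ;; set 5 (add (var 5) (const 1)))

/-- Store the tails and heads of the arcs at the hub in arrays `7` and `8`. -/
def buildHub : Program :=
  set 5 (const 0) ;;
  loop (sub numNodes (var 5))
    (write 7 (add numStatic (var 5)) (var 5) ;; write 8 (add numStatic (var 5)) numNodes ;;
      write 7 (add (add numStatic numNodes) (var 5)) numNodes ;;
      write 8 (add (add numStatic numNodes) (var 5)) (var 5) ;;
      set 5 (add (var 5) (const 1)))

end Program

open Program

variable {I : Instance} {s t : Fin I.n} {a : ℚ≥0}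

theorem buildStatic_halts {σ : Memory} (hD : I.Reads (σ 0)) :
    Halts buildStatic σ (200 * (I.m + 2)) fun σ' => ∀ e : Fin I.m,
      σ' 7 e = (I.ends e).1 ∧ σ' 8 e = (I.ends e).2 ∧
      σ' 7 (I.m + e) = (I.ends e).2 ∧ σ' 8 (I.m + e) = (I.ends e).1 := by
  refine Halts.seq (T := 40) (LoopFree.halts (by simp [LoopFree]) (by decide) rfl)
    (T' := 200 * (I.m + 1))
    -- Each static link occupies six input entries, namely two endpoints and two fractions; `τ 6 0`
    -- points to the current record.
    (fun σ' h => Halts.loop 100 (fun r τ => τ 0 = σ 0 ∧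
      τ 6 0 = 2 + 6 * τ 5 0 ∧ τ 5 0 ≤ I.m ∧ r = I.m - τ 5 0 ∧ ∀ e : Fin I.m, (e : ℕ) < τ 5 0 →
        τ 7 e = (I.ends e).1 ∧ τ 8 e = (I.ends e).2 ∧
        τ 7 (I.m + e) = (I.ends e).2 ∧ τ 8 (I.m + e) = (I.ends e).1) (r := I.m)
      ?_ ?_ ?_ ?_) (by omega)
  · subst h
    simp [exec, Expr.eval]
  · rintro r τ ⟨h0, h6, h5, rfl, h7⟩ hb
    simp only [Expr.eval, h0, hD.m] at hb
    refine LoopFree.halts (by simp [LoopFree]) (by decide) ⟨I.m - (τ 5 0 + 1), by omega, ?_⟩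
    obtain ⟨h8, h9⟩ := hD.ends ⟨τ 5 0, by omega⟩
    simp only at h8 h9
    simp [exec, Expr.eval, h0, h6, hD.m, h8, h9]
    refine ⟨by ring, by omega, fun e he => ?_⟩
    have he' := e.2
    rcases Nat.lt_or_eq_of_le he with he | he
    · obtain ⟨h10, h11, h12, h13⟩ := h7 e he
      simp only [Function.update_apply, h10, h11, h12, h13]
      split_ifs <;> omega
    · have hfin : (⟨τ 5 0, by omega⟩ : Fin I.m) = e := Fin.ext he.symm
      simp only [Function.update_apply, hfin, he]
      split_ifs <;> omega
  · rintro r τ ⟨h0, h2, h5, rfl, h7⟩ hb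
    simp only [Expr.eval, h0, hD.m] at hb
    exact fun e => h7 e (by omega)
  · simp only [Expr.cost]
    omega

theorem buildHub_halts {σ : Memory} (hD : I.Reads (σ 0))
    (hσ : ∀ e : Fin I.m, σ 7 e = (I.ends e).1 ∧ σ 8 e = (I.ends e).2 ∧
      σ 7 (I.m + e) = (I.ends e).2 ∧ σ 8 (I.m + e) = (I.ends e).1) :
    Halts buildHub σ (200 * (I.n + 2)) fun σ' => I.HubNetwork (σ' 7) (σ' 8) := by
  refine Halts.seq (T := 40) (LoopFree.halts (by simp [LoopFree]) (by decide) rfl)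
    (T' := 200 * (I.n + 1))
    (fun σ' h => Halts.loop 100 (fun r τ => τ 0 = σ 0 ∧ τ 5 0 ≤ I.n ∧ r = I.n - τ 5 0 ∧
      (∀ i < I.m + I.m, τ 7 i = σ 7 i ∧ τ 8 i = σ 8 i) ∧
      ∀ v < τ 5 0, τ 7 (I.m + I.m + v) = v ∧ τ 8 (I.m + I.m + v) = I.n ∧
        τ 7 (I.m + I.m + I.n + v) = I.n ∧ τ 8 (I.m + I.m + I.n + v) = v) (r := I.n)
      ?_ ?_ ?_ ?_) (by omega)
  · subst h
    simp [exec, Expr.eval]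
  · rintro r τ ⟨h0, h5, rfl, h6, h7⟩ hb
    simp only [Expr.eval, h0, hD.n] at hb
    refine LoopFree.halts (by simp [LoopFree]) (by decide) ⟨I.n - (τ 5 0 + 1), by omega, ?_⟩
    simp [exec, Expr.eval, h0, hD.n, hD.m]
    refine ⟨by omega, fun i hi => ?_, fun v hv => ?_⟩
    · obtain ⟨h10, h11⟩ := h6 i hi
      simp only [Function.update_apply, h10, h11]
      split_ifs <;> omega
    · rcases Nat.lt_or_eq_of_le hv with he | rfl
      · obtain ⟨h10, h11, h12, h13⟩ := h7 v he
        simp only [Function.update_apply, h10, h11, h12, h13]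
        split_ifs <;> omega
      · simp only [Function.update_apply]
        split_ifs <;> omega
  · rintro r τ ⟨h0, h5, rfl, h6, h7⟩ hb
    simp only [Expr.eval, h0, hD.n] at hb
    refine ⟨fun e => ?_, fun v hv => h7 v (by omega)⟩
    have he := e.2
    have h1 := h6 e (by omega)
    have h2 := h6 (I.m + e) (by omega)
    rw [h1.1, h1.2, h2.1, h2.2]
    exact hσ e
  · simp only [Expr.cost]
    omega

end MCRN

namespace MCRN

/-! ### Maximum flow -/

/-- `par` stores, for every node with positive mark except `s`, an arc that enters it from a node
with a smaller positive mark. -/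
def SearchForest (N n s : ℕ) (S D mark par : ℕ → ℕ) : Prop :=
  ∀ v ≤ n, mark v ≠ 0 → v ≠ s → par v < N ∧ D (par v) = v ∧ mark (S (par v)) ≠ 0 ∧
    mark (S (par v)) < mark v

namespace Program

open MCRN.Expr

/-- Erase all marks. -/
def clearMarks : Program :=
  set 5 (const 0) ;;
  loop (sub (add numNodes (const 1)) (var 5))
    (write 9 (var 5) (const 0) ;; set 5 (add (var 5) (const 1)))

/-- One step of the search: if arc number `var 5` leads from a marked to an unmarked node, then mark
the latter and start again with the first arc. -/
def searchStep : Program :=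
  ite (read 9 (read 7 (var 5)))
    (ite (read 9 (read 8 (var 5)))
      (set 5 (add (var 5) (const 1)))
      (set 11 (add (var 11) (const 1)) ;; write 9 (read 8 (var 5)) (var 11) ;;
        write 10 (read 8 (var 5)) (var 5) ;; set 5 (const 0)))
    (set 5 (add (var 5) (const 1)))

/-- Mark, in array `9`, the nodes reachable from the source. -/
def search : Program :=
  clearMarks ;; (write 9 (var 3) (const 1) ;; set 11 (const 1) ;; set 5 (const 0)) ;;
  loop (sub numArcs (var 5)) searchStep

/-- Reverse the arcs of the path found by the search. -/
def augment : Program :=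
  set 13 (var 4) ;;
  loop (add (sub (var 13) (var 3)) (sub (var 3) (var 13)))
    (set 14 (read 7 (read 10 (var 13))) ;; write 7 (read 10 (var 13)) (var 13) ;;
      write 8 (read 10 (var 13)) (var 14) ;; set 13 (var 14))

/-- Reverse paths from the source to the sink as long as there are any. -/
def maxFlow : Program :=
  set 12 (const 1) ;;
  loop (var 12) (search ;; ite (read 9 (var 4)) augment (set 12 (const 0)))

end Program

open Program

variable {I : Instance} {s t : Fin I.n}

theorem clearMarks_halts {σ : Memory} {n : ℕ} (hn : σ 0 0 = n) :
    Halts clearMarks σ (40 * (n + 3)) fun σ' => ∀ v ≤ n, σ' 9 v = 0 := by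
  refine Halts.seq (T := 10) (LoopFree.halts (by simp [LoopFree]) (by decide) rfl)
    (T' := 40 * (n + 2))
    (fun σ' h => Halts.loop 20 (fun r τ => τ 0 0 = n ∧ τ 5 0 ≤ n + 1 ∧ r = n + 1 - τ 5 0 ∧
      ∀ v < τ 5 0, τ 9 v = 0) (r := n + 1) ?_ ?_ ?_ ?_) (by omega)
  · subst h
    simp [exec, Expr.eval, hn]
  · rintro r τ ⟨h0, h5, rfl, h6⟩ hb
    simp only [Expr.eval, h0] at hb
    refine LoopFree.halts (by simp [LoopFree]) (by decide) ⟨n + 1 - (τ 5 0 + 1), by omega, ?_⟩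
    simp [exec, Expr.eval, h0]
    refine ⟨by omega, fun v hv => ?_⟩
    rcases Nat.lt_or_eq_of_le hv with he | rfl
    · rw [Function.update_of_ne he.ne, h6 v he]
    · simp
  · rintro r τ ⟨h0, h5, rfl, h6⟩ hb
    simp only [Expr.eval, h0] at hb
    exact fun v hv => h6 v (by omega)
  · simp only [Expr.cost]
    omega

/-- The invariant of the search after `cnt` nodes have been marked and `i` arcs been checked. -/
structure SearchInv (N n s : ℕ) (S D mark par : ℕ → ℕ) (cnt i : ℕ) : Prop where
  start : mark s ≠ 0
  forest : SearchForest N n s S D mark par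
  le_cnt : ∀ v ≤ n, mark v ≤ cnt
  card : ((Finset.range (n + 1)).filter fun v => mark v ≠ 0).card = cnt
  closed : ∀ j < i, mark (S j) ≠ 0 → mark (D j) ≠ 0
  le : i ≤ N

namespace SearchInv

variable {N n s cnt i : ℕ} {S D mark par : ℕ → ℕ}

theorem cnt_le (h : SearchInv N n s S D mark par cnt i) : cnt ≤ n + 1 := by
  rw [← h.card]
  exact (Finset.card_filter_le _ _).trans (by simp)

theorem next (h : SearchInv N n s S D mark par cnt i) (hi : i < N)
    (hc : mark (S i) ≠ 0 → mark (D i) ≠ 0) : SearchInv N n s S D mark par cnt (i + 1) where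
  start := h.start
  forest := h.forest
  le_cnt := h.le_cnt
  card := h.card
  closed j hj := by
    rcases Nat.lt_succ_iff_lt_or_eq.1 hj with hj | rfl
    · exact h.closed j hj
    · exact hc
  le := hi

/-- The new mark exceeds all earlier ones, so the parent has a smaller mark; older parent arcs start
at marked nodes, hence not at `D i`, and stay valid. The arc counter returns to 0 because the new
mark may open arcs already checked. -/
theorem mark_node (h : SearchInv N n s S D mark par cnt i) (hi : i < N) (hS : S i ≤ n) (hDi : D i ≤ n)
    (hSi : mark (S i) ≠ 0) (hD0 : mark (D i) = 0) :
    SearchInv N n s S D (Function.update mark (D i) (cnt + 1)) (Function.update par (D i) i)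
      (cnt + 1) 0 where
  start := by
    rw [Function.update_apply]
    split_ifs
    · omega
    · exact h.start
  forest v hv hm hvs := by
    by_cases hvD : v = D i
    · subst hvD
      have hne : S i ≠ D i := fun he => hSi (he ▸ hD0)
      have := h.le_cnt _ hS
      rw [Function.update_self, Function.update_self, Function.update_of_ne hne]
      exact ⟨hi, rfl, hSi, by omega⟩
    · rw [Function.update_of_ne hvD] at hm
      obtain ⟨h1, h2, h3, h4⟩ := h.forest v hv hm hvs
      have hne : S (par v) ≠ D i := fun he => h3 (he ▸ hD0)
      rw [Function.update_of_ne hvD, Function.update_of_ne hvD, Function.update_of_ne hne]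
      exact ⟨h1, h2, h3, h4⟩
  le_cnt v hv := by
    have := h.le_cnt v hv
    rw [Function.update_apply]
    split_ifs <;> omega
  card := by
    have : ((Finset.range (n + 1)).filter fun v => Function.update mark (D i) (cnt + 1) v ≠ 0) =
        insert (D i) ((Finset.range (n + 1)).filter fun v => mark v ≠ 0) := by
      ext v
      simp only [Finset.mem_filter, Finset.mem_range, Finset.mem_insert, Function.update_apply]
      grind
    rw [this, Finset.card_insert_of_notMem (by simp [hD0]), h.card]
  closed := by simp
  le := Nat.zero_le _

end SearchInv

/-- Each step either advances the arc counter or marks a node and resets the counter. The variant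
encodes this lexicographic progress, with weight N + 1 for each node still unmarked. -/
theorem search_halts {σ : Memory} {n m s : ℕ} (hn : σ 0 0 = n) (hm : σ 0 1 = m) (hs : σ 3 0 = s)
    (hsn : s ≤ n) (hle : ∀ i < m + m + n + n, σ 7 i ≤ n ∧ σ 8 i ≤ n) :
    Halts search σ (300 * ((n + 1) * (m + m + n + n + 1) + n + 3)) fun σ' =>
      σ' 9 s ≠ 0 ∧ SearchForest (m + m + n + n) n s (σ 7) (σ 8) (σ' 9) (σ' 10) ∧
      (∀ v ≤ n, σ' 9 v ≤ n + 1) ∧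
      ∀ i < m + m + n + n, σ' 9 (σ 7 i) ≠ 0 → σ' 9 (σ 8 i) ≠ 0 := by
  set N := m + m + n + n with hN
  refine Halts.seq (T := 40 * (n + 3)) (clearMarks_halts hn).frame
    (T' := 40 + 200 * ((n + 1) * (N + 1) + 1)) (fun σ₁ h => ?_) (by nlinarith)
  obtain ⟨h9, hfr⟩ := h
  have h0 : σ₁ 0 = σ 0 := hfr 0 (by decide)
  have h3 : σ₁ 3 = σ 3 := hfr 3 (by decide)
  have h7 : σ₁ 7 = σ 7 := hfr 7 (by decide)
  have h8 : σ₁ 8 = σ 8 := hfr 8 (by decide)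
  refine Halts.seq (T := 40) (LoopFree.halts (by simp [LoopFree]) (by decide) rfl)
    (T' := 200 * ((n + 1) * (N + 1) + 1)) (fun σ' h => Halts.loop 150 (fun r τ => τ 0 = σ 0 ∧
      τ 7 = σ 7 ∧ τ 8 = σ 8 ∧ SearchInv N n s (σ 7) (σ 8) (τ 9) (τ 10) (τ 11 0) (τ 5 0) ∧
      r = (n + 1 - τ 11 0) * (N + 1) + (N - τ 5 0)) (r := (n + 1 - 1) * (N + 1) + N)
      ?_ ?_ ?_ ?_) (by omega)
  · subst h
    have hmark : ∀ v ≤ n, Function.update (σ₁ 9) s 1 v = if v = s then 1 else 0 := by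
      intro v hv
      rw [Function.update_apply, h9 v hv]
    simp [exec, Expr.eval, h0, h3, h7, h8, hs]
    refine ⟨by simp, ?_, ?_, ?_, by simp, by omega⟩
    · intro v hv hm hvs
      rw [hmark v hv, if_neg hvs] at hm
      exact (hm rfl).elim
    · intro v hv
      rw [hmark v hv]
      split_ifs <;> omega
    · rw [Finset.card_eq_one]
      refine ⟨s, ?_⟩
      ext v
      simp only [Finset.mem_filter, Finset.mem_range, Finset.mem_singleton]
      constructor
      · rintro ⟨hv, h⟩
        rw [hmark v (by omega)] at h
        by_contra hne
        exact h (if_neg hne)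
      · rintro rfl
        exact ⟨by omega, by simp⟩
  · rintro r τ ⟨h0, h7, h8, hinv, rfl⟩ hb
    simp only [Expr.eval, h0, hn, hm, ← hN] at hb
    have hi : τ 5 0 < N := by omega
    have hcl := hle _ hi
    have hcnt := hinv.cnt_le
    by_cases hS : τ 9 (σ 7 (τ 5 0)) = 0
    · refine LoopFree.halts (by simp [LoopFree, searchStep]) (by decide)
        ⟨(n + 1 - τ 11 0) * (N + 1) + (N - (τ 5 0 + 1)), by omega, ?_⟩
      have := hinv.next hi (fun h => (h hS).elim)
      simpa [searchStep, exec, Expr.eval, h0, h7, h8, hS] using this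
    · by_cases hD : τ 9 (σ 8 (τ 5 0)) = 0
      · have hmk := hinv.mark_node hi hcl.1 hcl.2 hS hD
        have hcnt' := hmk.cnt_le
        refine LoopFree.halts (by simp [LoopFree, searchStep]) (by decide)
          ⟨(n + 1 - (τ 11 0 + 1)) * (N + 1) + (N - 0), ?_, ?_⟩
        · rw [show n + 1 - τ 11 0 = (n + 1 - (τ 11 0 + 1)) + 1 by omega, Nat.succ_mul]
          omega
        · simpa [searchStep, exec, Expr.eval, h0, h7, h8, hS, hD] using hmk
      · refine LoopFree.halts (by simp [LoopFree, searchStep]) (by decide)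
          ⟨(n + 1 - τ 11 0) * (N + 1) + (N - (τ 5 0 + 1)), by omega, ?_⟩
        have := hinv.next hi (fun _ => hD)
        simpa [searchStep, exec, Expr.eval, h0, h7, h8, hS, hD] using this
  · rintro r τ ⟨h0, h7, h8, hinv, rfl⟩ hb
    simp only [Expr.eval, h0, hn, hm, ← hN] at hb
    exact ⟨hinv.start, hinv.forest, fun v hv => (hinv.le_cnt v hv).trans hinv.cnt_le,
      fun i hi => hinv.closed i (by omega)⟩
  · simp only [Expr.cost]
    have : (n + 1 - 1) * (N + 1) + N + 1 = (n + 1) * (N + 1) := by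
      rw [Nat.add_sub_cancel]
      ring
    rw [this]
    nlinarith

/-- The path is traversed from `t` back to `s`; the marks strictly decrease along parents, so the
mark of the current node serves as variant. -/
theorem augment_halts {σ : Memory} {N n s t k : ℕ} {S₀ D₀ : ℕ → ℕ}
    (hs : σ 3 0 = s) (ht : σ 4 0 = t) (htn : t ≤ n)
    (hle : ∀ i < N, σ 7 i ≤ n ∧ σ 8 i ≤ n)
    (hr : ReversesFlow N S₀ D₀ (σ 7) (σ 8) s t k)
    (hforest : SearchForest N n s (σ 7) (σ 8) (σ 9) (σ 10)) (hmark : ∀ v ≤ n, σ 9 v ≤ n + 1)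
    (ht0 : σ 9 t ≠ 0) :
    Halts augment σ (60 * (n + 4)) fun σ' => ReversesFlow N S₀ D₀ (σ' 7) (σ' 8) s t (k + 1) := by
  refine Halts.seq (T := 10) (LoopFree.halts (by simp [LoopFree]) (by decide) rfl)
    (T' := 60 * (n + 3)) (fun σ' h => Halts.loop 40 (fun r τ =>
      (τ 3 0 = s ∧ τ 9 = σ 9 ∧ τ 10 = σ 10) ∧ τ 13 0 ≤ n ∧ τ 9 (τ 13 0) ≠ 0 ∧
      (∀ i < N, (τ 7 i = S₀ i ∧ τ 8 i = D₀ i) ∨ (τ 7 i = D₀ i ∧ τ 8 i = S₀ i)) ∧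
      -- With only the final part of the path reversed, the additional surplus sits at `t` and the
      -- deficit at the current node.
      (∀ v, degDiff N (τ 7) (τ 8) v = (if v = t then 2 * (k : ℤ) else 0) -
        (if v = s then 2 * (k : ℤ) else 0) + (if v = t then 2 else 0) -
        (if v = τ 13 0 then 2 else 0)) ∧
      (∀ i < N, τ 7 i ≤ n ∧ τ 8 i ≤ n) ∧
      (∀ v ≤ n, τ 9 v ≠ 0 → τ 9 v ≤ τ 9 (τ 13 0) → v ≠ s → τ 10 v < N ∧ τ 8 (τ 10 v) = v ∧
        τ 9 (τ 7 (τ 10 v)) ≠ 0 ∧ τ 9 (τ 7 (τ 10 v)) < τ 9 v) ∧ r = τ 9 (τ 13 0)) (r := σ 9 t)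
      ?_ ?_ ?_ ?_) (by omega)
  · subst h
    simp only [exec, Expr.eval, Function.update_self, ne_eq, not_false_eq_true,
      Function.update_of_ne, Nat.reduceEqDiff, ht, hs]
    exact ⟨⟨trivial, trivial, trivial⟩, htn, ht0, hr.reoriented,
      fun v => by rw [hr.degDiff_eq]; ring, hle, fun v hv hm _ hvs => hforest v hv hm hvs, trivial⟩
  · rintro r τ ⟨⟨h3, h9, h10⟩, hvn, hv0, hro, hdeg, hle, hfor, rfl⟩ hb
    simp only [Expr.eval, h3] at hb
    set v := τ 13 0 with hv
    obtain ⟨hi, hDi, hS0, hSlt⟩ := hfor v hvn hv0 le_rfl (by omega)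
    set i := τ 10 v with hi'
    refine LoopFree.halts (by simp [LoopFree]) (by decide) ⟨τ 9 (τ 7 i), hSlt, ?_⟩
    simp only [exec, Expr.eval, Function.update_self, ne_eq, not_false_eq_true,
      Function.update_of_ne, Nat.reduceEqDiff, ← hv, ← hi', h3]
    refine ⟨⟨trivial, h9, h10⟩, (hle i hi).1, hS0, ?_, ?_, ?_, ?_, trivial⟩
    · intro j hj
      by_cases hji : j = i
      · subst hji
        rw [Function.update_self, Function.update_self, ← hDi]
        exact (hro _ hj).symm.imp And.symm And.symm
      · rw [Function.update_of_ne hji, Function.update_of_ne hji]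
        exact hro j hj
    · intro w
      have h1 := degDiff_update (S := τ 7) (D := τ 8) hi w
      rw [hDi] at h1
      rw [h1, hdeg]
      ring
    · intro j hj
      simp only [Function.update_apply]
      have h1 := hle j hj
      have h2 := hle i hi
      split_ifs <;> omega
    · intro w hw hw0 hwle hws
      obtain ⟨h1, h2, h3, h4⟩ := hfor w hw hw0 (by omega) hws
      -- The arc just reversed was the parent arc of `v`, whose mark exceeds all marks for which the
      -- forest is still needed.
      have hne : τ 10 w ≠ i := by
        intro he
        rw [he, hDi] at h2
        rw [h2] at hSlt
        omega
      rw [Function.update_of_ne hne, Function.update_of_ne hne]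
      exact ⟨h1, h2, h3, h4⟩
  · rintro r τ ⟨⟨h3, h9, h10⟩, hvn, hv0, hro, hdeg, hle, hfor, rfl⟩ hb
    simp only [Expr.eval, h3] at hb
    refine ⟨hro, fun v => ?_⟩
    rw [hdeg, show τ 13 0 = s by omega]
    push_cast
    split_ifs <;> ring
  · simp only [Expr.cost]
    have := hmark t htn
    omega

theorem maxFlow_halts {σ : Memory} {n m s t : ℕ} {S₀ D₀ : ℕ → ℕ} (hn : σ 0 0 = n) (hm : σ 0 1 = m)
    (hs : σ 3 0 = s) (ht : σ 4 0 = t) (hsn : s ≤ n) (htn : t ≤ n) (hst : s ≠ t)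
    (hle : ∀ i < m + m + n + n, S₀ i ≤ n ∧ D₀ i ≤ n)
    (hr : ReversesFlow (m + m + n + n) S₀ D₀ (σ 7) (σ 8) s t 0) :
    Halts maxFlow σ (400 * (m + m + n + n + 3) * ((n + 1) * (m + m + n + n + 1) + n + 4))
      fun σ' => ∃ k, ReversesFlow (m + m + n + n) S₀ D₀ (σ' 7) (σ' 8) s t k ∧
        σ' 9 s ≠ 0 ∧ σ' 9 t = 0 ∧
        ∀ i < m + m + n + n, σ' 9 (σ' 7 i) ≠ 0 → σ' 9 (σ' 8 i) ≠ 0 := by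
  set N := m + m + n + n with hN
  refine Halts.seq (T := 10) (LoopFree.halts (by simp [LoopFree]) (by decide) rfl)
    (T' := (N + 2) * (370 * ((n + 1) * (N + 1) + n + 4))) (fun σ' h => Halts.loop
    (300 * ((n + 1) * (N + 1) + n + 3) + (10 + 60 * (n + 4))) (fun r τ =>
      (τ 0 = σ 0 ∧ τ 3 0 = s ∧ τ 4 0 = t) ∧
      ∃ k, ReversesFlow N S₀ D₀ (τ 7) (τ 8) s t k ∧
        -- Since 2k ≤ N, the variant is positive while the flag is set, so clearing the flag may
        -- lower it to 0.
        ((τ 12 0 ≠ 0 ∧ r = N + 1 - k) ∨ (τ 12 0 = 0 ∧ r = 0 ∧ τ 9 s ≠ 0 ∧ τ 9 t = 0 ∧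
        ∀ i < N, τ 9 (τ 7 i) ≠ 0 → τ 9 (τ 8 i) ≠ 0))) (r := N + 1)
      ?_ ?_ ?_ ?_) ?_
  rotate_right
  · have : (N + 2) * 4 ≤ (N + 2) * ((n + 1) * (N + 1) + n + 4) :=
      Nat.mul_le_mul_left _ (Nat.le_add_left 4 _)
    nlinarith
  · subst h
    simp only [exec, Expr.eval, Function.update_self, ne_eq, not_false_eq_true,
      Function.update_of_ne, Nat.reduceEqDiff, ht, hs,
      OfNat.zero_ne_ofNat]
    exact ⟨⟨trivial, trivial, trivial⟩, 0, hr, Or.inl ⟨trivial, rfl⟩⟩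
  · rintro r τ ⟨⟨h0, h3, h4⟩, k, hk, hor⟩ hb
    simp only [Expr.eval] at hb
    obtain ⟨-, rfl⟩ := hor.resolve_right fun h => hb h.1
    have hkN := hk.two_mul_le hst
    have hle' : ∀ i < N, τ 7 i ≤ n ∧ τ 8 i ≤ n := by
      intro i hi
      have h1 := hle i hi
      have h2 := hk.reoriented i hi
      omega
    refine Halts.seq (search_halts (by rw [h0, hn]) (by rw [h0, hm]) h3 hsn hle').frame
      (fun τ₁ h => ?_) le_rfl
    obtain ⟨⟨hs0, hfor, hmark, hcl⟩, hfr⟩ := h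
    have e0 : τ₁ 0 = τ 0 := hfr 0 (by decide)
    have e3 : τ₁ 3 = τ 3 := hfr 3 (by decide)
    have e4 : τ₁ 4 = τ 4 := hfr 4 (by decide)
    have e7 : τ₁ 7 = τ 7 := hfr 7 (by decide)
    have e8 : τ₁ 8 = τ 8 := hfr 8 (by decide)
    have e12 : τ₁ 12 = τ 12 := hfr 12 (by decide)
    rw [← e7, ← e8] at hfor hk hle' hcl
    refine Halts.ite (T := 60 * (n + 4)) (fun hb' => ?_) (fun hb' => ?_)
      (by simp only [Expr.cost]; omega)
    · simp only [Expr.eval, e4, h4] at hb'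
      refine (augment_halts (by rw [e3, h3]) (by rw [e4, h4]) htn hle' hk hfor hmark hb').frame.mono
        le_rfl ?_
      rintro τ₂ ⟨hk', hfr'⟩
      have hkN' := hk'.two_mul_le hst
      refine ⟨N + 1 - (k + 1), by omega, ⟨?_, ?_, ?_⟩, k + 1, hk', Or.inl ⟨?_, rfl⟩⟩
      · rw [hfr' 0 (by decide), e0, h0]
      · rw [hfr' 3 (by decide), e3, h3]
      · rw [hfr' 4 (by decide), e4, h4]
      · rw [hfr' 12 (by decide), e12]
        exact hb
    · simp only [Expr.eval, e4, h4] at hb'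
      refine LoopFree.halts (T := 60 * (n + 4)) (by simp [LoopFree])
        (by simp only [maxCost, Expr.cost]; omega) ⟨0, by omega, ?_⟩
      simp only [exec, Expr.eval, Function.update_self, ne_eq, not_false_eq_true,
        Function.update_of_ne, Nat.reduceEqDiff, e0, h0, e3, h3, e4, h4,
        OfNat.zero_ne_ofNat]
      exact ⟨⟨trivial, trivial, trivial⟩, k, hk, Or.inr ⟨trivial, trivial, hs0, hb', hcl⟩⟩
  · rintro r τ ⟨⟨h0, h3, h4⟩, k, hk, hor⟩ hb
    simp only [Expr.eval] at hb
    obtain ⟨-, -, h⟩ := hor.resolve_left fun h => h.1 hb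
    exact ⟨k, hk, h⟩
  · refine Nat.mul_le_mul_left _ ?_
    simp only [Expr.cost]
    nlinarith

end MCRN

namespace MCRN

/-! ### Pairing senders with receivers -/

/-- `out` encodes a partial matching between `A` and `B`. -/
def PairsUp (n : ℕ) (A B : ℕ → Prop) (out : ℕ → ℕ) : Prop :=
  ∀ u < n, out u = 0 ∨
    ∃ v < n, out u = v + 1 ∧ out v = u + 1 ∧ ((A u ∧ B v) ∨ (B u ∧ A v))

theorem PairsUp.symm {n : ℕ} {A B : ℕ → Prop} {out : ℕ → ℕ} (h : PairsUp n A B out) :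
    PairsUp n B A out := fun u hu =>
  (h u hu).imp_right fun ⟨v, h1, h2, h3, h4⟩ => ⟨v, h1, h2, h3, h4.symm⟩

/-- Partners embed `A` into `B`, and equal cardinality makes this embedding onto. -/
theorem PairsUp.covers {n : ℕ} {A B : ℕ → Prop} [DecidablePred A] [DecidablePred B] {out : ℕ → ℕ}
    (h : PairsUp n A B out) (hAB : ∀ u < n, A u → ¬ B u)
    (hcard : ((Finset.range n).filter A).card = ((Finset.range n).filter B).card)
    (hA : ∀ u < n, A u → out u ≠ 0) : ∀ v < n, B v → out v ≠ 0 := by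
  have hpart : ∀ u ∈ (Finset.range n).filter A,
      ∃ v < n, out u = v + 1 ∧ out v = u + 1 ∧ B v := by
    intro u hu
    obtain ⟨hu, hAu⟩ := Finset.mem_filter.1 hu
    rw [Finset.mem_range] at hu
    obtain ⟨v, h1, h2, h3, h4⟩ := (h u hu).resolve_left (hA u hu hAu)
    exact ⟨v, h1, h2, h3, (h4.resolve_right fun h => hAB u hu hAu h.1).2⟩
  have himage : ((Finset.range n).filter A).image (fun u => out u - 1) =
      (Finset.range n).filter B := by
    refine Finset.eq_of_subset_of_card_le ?_ ?_
    · intro v hv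
      obtain ⟨u, hu, rfl⟩ := Finset.mem_image.1 hv
      obtain ⟨v, h1, h2, h3, h4⟩ := hpart u hu
      rw [h2, Nat.add_sub_cancel]
      exact Finset.mem_filter.2 ⟨Finset.mem_range.2 h1, h4⟩
    · rw [← hcard, Finset.card_image_of_injOn]
      intro u hu u' hu' he
      obtain ⟨v, h1, h2, h3, h4⟩ := hpart u hu
      obtain ⟨v', h1', h2', h3', h4'⟩ := hpart u' hu'
      simp only [h2, h2', Nat.add_sub_cancel] at he
      subst he
      omega
  intro v hv hBv
  have hmem : v ∈ (Finset.range n).filter B := Finset.mem_filter.2 ⟨Finset.mem_range.2 hv, hBv⟩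
  rw [← himage] at hmem
  obtain ⟨u, hu, rfl⟩ := Finset.mem_image.1 hmem
  obtain ⟨v, h1, h2, h3, h4⟩ := hpart u hu
  rw [h2, Nat.add_sub_cancel, h3]
  omega

/-- The invariant of the pairing: the nodes of `A` below `i` and of `B` below `j` are matched. -/
structure PairInv (n : ℕ) (A B : ℕ → Prop) (out : ℕ → ℕ) (i j : ℕ) : Prop where
  pairs : PairsUp n A B out
  left_le : i ≤ n
  right_le : j ≤ n
  left_done : ∀ u < i, A u → out u ≠ 0
  right_done : ∀ v < j, B v → out v ≠ 0
  left_todo : ∀ u < n, i ≤ u → A u → out u = 0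
  right_todo : ∀ v < n, j ≤ v → B v → out v = 0

namespace PairInv

variable {n i j : ℕ} {A B : ℕ → Prop} {out : ℕ → ℕ}

theorem symm (h : PairInv n A B out i j) : PairInv n B A out j i where
  pairs := h.pairs.symm
  left_le := h.right_le
  right_le := h.left_le
  left_done := h.right_done
  right_done := h.left_done
  left_todo := h.right_todo
  right_todo := h.left_todo

theorem skip_left (h : PairInv n A B out i j) (hi : i < n) (hA : ¬ A i) :
    PairInv n A B out (i + 1) j where
  pairs := h.pairs
  left_le := hi
  right_le := h.right_le
  left_done u hu hAu := by
    rcases Nat.lt_succ_iff_lt_or_eq.1 hu with hu | rfl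
    · exact h.left_done u hu hAu
    · exact (hA hAu).elim
  right_done := h.right_done
  left_todo u hu hle := h.left_todo u hu (by omega)
  right_todo := h.right_todo

theorem skip_right (h : PairInv n A B out i j) (hj : j < n) (hB : ¬ B j) :
    PairInv n A B out i (j + 1) := (h.symm.skip_left hj hB).symm

theorem join (h : PairInv n A B out i j) (hAB : ∀ u < n, A u → ¬ B u) (hi : i < n) (hj : j < n)
    (hA : A i) (hB : B j) :
    PairInv n A B (Function.update (Function.update out i (j + 1)) j (i + 1)) (i + 1) (j + 1) := by
  have hij : i ≠ j := fun he => hAB i hi hA (he ▸ hB)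
  have hi0 := h.left_todo i hi le_rfl hA
  have hj0 := h.right_todo j hj le_rfl hB
  have heval : ∀ u, Function.update (Function.update out i (j + 1)) j (i + 1) u =
      if u = j then i + 1 else if u = i then j + 1 else out u := by
    intro u
    simp only [Function.update_apply]
  refine ⟨?_, hi, hj, ?_, ?_, ?_, ?_⟩
  · intro u hu
    by_cases huj : u = j
    · subst huj
      exact Or.inr ⟨i, hi, by rw [heval, if_pos rfl], by rw [heval, if_neg hij, if_pos rfl],
        Or.inr ⟨hB, hA⟩⟩
    by_cases hui : u = i
    · subst hui
      exact Or.inr ⟨j, hj, by rw [heval, if_neg hij, if_pos rfl], by rw [heval, if_pos rfl],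
        Or.inl ⟨hA, hB⟩⟩
    refine (h.pairs u hu).imp (fun h0 => ?_) fun ⟨v, h1, h2, h3, h4⟩ => ⟨v, h1, ?_, ?_, h4⟩
    · rw [heval, if_neg huj, if_neg hui, h0]
    · rw [heval, if_neg huj, if_neg hui, h2]
    · rw [heval, if_neg (fun he => by subst he; omega), if_neg (fun he => by subst he; omega), h3]
  · intro u hu hAu
    rw [heval]
    split_ifs with h1 h2
    · omega
    · omega
    · exact h.left_done u (by omega) hAu
  · intro u hu hBu
    rw [heval]
    split_ifs with h1 h2
    · omega
    · omega
    · exact h.right_done u (by omega) hBu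
  · intro u hu hle hAu
    rw [heval, if_neg (fun he : u = j => hAB u hu hAu (he ▸ hB)), if_neg (by omega)]
    exact h.left_todo u hu (by omega) hAu
  · intro u hu hle hBu
    rw [heval, if_neg (by omega), if_neg (fun he : u = i => hAB u hu (he ▸ hA) hBu)]
    exact h.right_todo u hu (by omega) hBu

end PairInv

namespace Program

open MCRN.Expr

/-- Tests whether node `var 5` sends flow to the hub. -/
def isSender : Expr :=
  sub (const 1) (add (sub numNodes (read 7 (add numStatic (var 5))))
    (sub numNodes (read 7 (add (add numStatic numNodes) (var 5)))))

/-- Tests whether node `var 6` receives flow from the hub. -/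
def isReceiver : Expr :=
  sub (const 1) (add (sub (read 7 (add numStatic (var 6))) (var 6))
    (sub (read 7 (add (add numStatic numNodes) (var 6))) (var 6)))

/-- Skip a node that is no sender or no receiver, or match a sender with a receiver. -/
def pairStep : Program :=
  ite isSender
    (ite isReceiver
      (write 1 (var 5) (add (var 6) (const 1)) ;; write 1 (var 6) (add (var 5) (const 1)) ;;
        set 5 (add (var 5) (const 1)) ;; set 6 (add (var 6) (const 1)))
      (set 6 (add (var 6) (const 1))))
    (set 5 (add (var 5) (const 1)))

/-- Match the senders with the receivers in increasing order. -/
def pair : Program :=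
  (set 5 (const 0) ;; set 6 (const 0)) ;;
  loop (sub (const 1) (add (sub (const 1) (sub numNodes (var 5)))
    (sub (const 1) (sub numNodes (var 6))))) pairStep

/-- The condition that source and sink differ. -/
def isProper : Expr := add (sub (var 3) (var 4)) (sub (var 4) (var 3))

/-- The algorithm for splittable routing. -/
def solveSplittable : Program :=
  seekDemand ;; scanDemand ;; ite isProper (buildStatic ;; buildHub ;; maxFlow ;; pair) skip

/-- The algorithm for unsplittable routing. -/
def solveUnsplittable : Program :=
  seekDemand ;; scanDemand ;; ite isProper
    (write 1 (var 3) (add (var 4) (const 1)) ;; write 1 (var 4) (add (var 3) (const 1))) skip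

end Program

open Program Instance.HubNetwork

/-- The loop ends when one side is exhausted; as senders and receivers are equally many, the other
side is then covered too. -/
theorem pair_halts {σ : Memory} {n m : ℕ} (hn : σ 0 0 = n) (hm : σ 0 1 = m)
    (hout : ∀ u, σ 1 u = 0)
    (hS : ∀ u < n, (σ 7 (m + m + u) = u ∨ σ 7 (m + m + u) = n) ∧
      (σ 7 (m + m + n + u) = u ∨ σ 7 (m + m + n + u) = n))
    (hcard : ((Finset.range n).filter (sender m n (σ 7))).card =
      ((Finset.range n).filter (receiver m n (σ 7))).card) :
    Halts pair σ (200 * (n + n + 2)) fun σ' =>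
      PairsUp n (sender m n (σ 7)) (receiver m n (σ 7)) (σ' 1) ∧
      ∀ u < n, sender m n (σ 7) u ∨ receiver m n (σ 7) u → σ' 1 u ≠ 0 := by
  have hdisj : ∀ u < n, sender m n (σ 7) u → ¬ receiver m n (σ 7) u := by
    intro u hu h1 h2
    have h3 := h1.1
    have h4 := h2.1
    omega
  refine Halts.seq (T := 10) (LoopFree.halts (by simp [LoopFree]) (by decide) rfl)
    (T' := 200 * (n + n + 1))
    (fun σ' h => Halts.loop 150 (fun r τ => (τ 0 = σ 0 ∧ τ 7 = σ 7) ∧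
      PairInv n (sender m n (σ 7)) (receiver m n (σ 7)) (τ 1) (τ 5 0) (τ 6 0) ∧
      r = n - τ 5 0 + (n - τ 6 0)) (r := n + n) ?_ ?_ ?_ ?_) (by omega)
  · subst h
    refine ⟨by simp [exec, Expr.eval], ?_, by simp [exec, Expr.eval]⟩
    simp only [exec, Expr.eval, Function.update_self, ne_eq, not_false_eq_true,
      Function.update_of_ne, Nat.reduceEqDiff, OfNat.one_ne_ofNat]
    exact ⟨fun u _ => Or.inl (hout u), Nat.zero_le _, Nat.zero_le _, by simp, by simp,
      fun u _ _ _ => hout u, fun u _ _ _ => hout u⟩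
  · rintro r τ ⟨⟨h0, h7⟩, hinv, rfl⟩ hb
    simp only [Expr.eval, h0, hn] at hb
    have hi : τ 5 0 < n := by omega
    have hj : τ 6 0 < n := by omega
    -- The tail of a hub arc of `u` is `u` or `n`, so truncated subtraction suffices: n - x = 0
    -- tests x = n, and x - u = 0 tests x = u.
    have hsend : isSender.eval τ = 0 ↔ ¬ sender m n (σ 7) (τ 5 0) := by
      have := hS _ hi
      simp only [isSender, Expr.eval, h0, h7, hn, hm, sender]
      omega
    have hrec : isReceiver.eval τ = 0 ↔ ¬ receiver m n (σ 7) (τ 6 0) := by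
      have := hS _ hj
      simp only [isReceiver, Expr.eval, h0, h7, hn, hm, receiver]
      omega
    by_cases hA : sender m n (σ 7) (τ 5 0)
    · have hb1 : isSender.eval τ ≠ 0 := fun h => hsend.1 h hA
      by_cases hB : receiver m n (σ 7) (τ 6 0)
      · have hb2 : isReceiver.eval τ ≠ 0 := fun h => hrec.1 h hB
        refine LoopFree.halts (by simp [LoopFree, pairStep]) (by decide)
          ⟨n - (τ 5 0 + 1) + (n - (τ 6 0 + 1)), by omega, ?_⟩
        have := hinv.join hdisj hi hj hA hB
        simpa [pairStep, exec, hb1, hb2, Expr.eval, h0, h7] using this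
      · have hb2 : isReceiver.eval τ = 0 := hrec.2 hB
        refine LoopFree.halts (by simp [LoopFree, pairStep]) (by decide)
          ⟨n - τ 5 0 + (n - (τ 6 0 + 1)), by omega, ?_⟩
        have := hinv.skip_right hj hB
        simpa [pairStep, exec, hb1, hb2, Expr.eval, h0, h7] using this
    · have hb1 : isSender.eval τ = 0 := hsend.2 hA
      refine LoopFree.halts (by simp [LoopFree, pairStep]) (by decide)
        ⟨n - (τ 5 0 + 1) + (n - τ 6 0), by omega, ?_⟩
      have := hinv.skip_left hi hA
      simpa [pairStep, exec, hb1, Expr.eval, h0, h7] using this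
  · rintro r τ ⟨⟨h0, h7⟩, hinv, rfl⟩ hb
    simp only [Expr.eval, h0, hn] at hb
    have h5 := hinv.left_le
    have h6 := hinv.right_le
    refine ⟨hinv.pairs, ?_⟩
    rcases (by omega : τ 5 0 = n ∨ τ 6 0 = n) with he | he
    · have hA : ∀ u < n, sender m n (σ 7) u → τ 1 u ≠ 0 :=
        fun u hu => hinv.left_done u (by omega)
      exact fun u hu h => h.elim (hA u hu) (hinv.pairs.covers hdisj hcard hA u hu)
    · have hB : ∀ u < n, receiver m n (σ 7) u → τ 1 u ≠ 0 :=
        fun u hu => hinv.right_done u (by omega)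
      exact fun u hu h => h.elim (hinv.pairs.symm.covers (fun u hu h1 h2 => hdisj u hu h2 h1)
        hcard.symm hB u hu) (hB u hu)
  · simp only [Expr.cost]
    omega

/-! ### Correctness of the two algorithms -/

/-- The matching given by a table of partners. -/
def matchingOf {n : ℕ} (out : ℕ → ℕ) : SimpleGraph (Fin n) where
  Adj u v := u ≠ v ∧ out u = v + 1 ∧ out v = u + 1
  symm := ⟨fun _ _ h => ⟨h.1.symm, h.2.2, h.2.1⟩⟩
  loopless := ⟨fun _ h => h.1 rfl⟩

variable {I : Instance} {s t : Fin I.n} {a : ℚ≥0}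

theorem isReconfiguration_matchingOf (out : ℕ → ℕ) : I.IsReconfiguration (matchingOf out) := by
  intro u v w hv hw
  have h1 := hv.2.1
  have h2 := hw.2.1
  exact Fin.ext (by omega)

theorem represents_bot : I.Represents (fun _ => 0) ⊥ := fun _ => Or.inr ⟨fun _ h => h, rfl⟩

/-- The output is a correct solution of the instance `I`. -/
def Solves (I : Instance) (τ : Routing) (out : ℕ → ℕ) : Prop :=
  ∃ M : SimpleGraph (Fin I.n), I.Represents out M ∧ I.IsSolution τ M

theorem splittable_halts {σ : Memory} (hD : I.Reads (σ 0)) (hc : I.IsCommodity s t a)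
    (hst : s ≠ t) (hs : σ 3 0 = s) (ht : σ 4 0 = t) (hout : ∀ u, σ 1 u = 0) :
    Halts (buildStatic ;; buildHub ;; maxFlow ;; pair) σ
      (200 * (I.m + 2) + (200 * (I.n + 2) +
        (400 * (I.m + I.m + I.n + I.n + 3) * ((I.n + 1) * (I.m + I.m + I.n + I.n + 1) + I.n + 4) +
          200 * (I.n + I.n + 2))))
      fun σ' => Solves I Routing.SN (σ' 1) := by
  refine Halts.seq (buildStatic_halts hD).frame (fun σ₁ h => ?_) le_rfl
  obtain ⟨h1, f1⟩ := h
  have e0 : σ₁ 0 = σ 0 := f1 0 (by decide)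
  refine Halts.seq (buildHub_halts (by rwa [e0]) h1).frame (fun σ₂ h => ?_) le_rfl
  obtain ⟨hhub, f2⟩ := h
  have e0' : σ₂ 0 = σ 0 := (f2 0 (by decide)).trans e0
  -- The unmodified network represents the zero flow.
  have hr₀ : ReversesFlow (I.m + I.m + I.n + I.n) (σ₂ 7) (σ₂ 8) (σ₂ 7) (σ₂ 8) s t 0 :=
    ⟨fun i _ => Or.inl ⟨rfl, rfl⟩, fun v => by rw [hhub.degDiff_eq_zero]; simp⟩
  refine Halts.seq (maxFlow_halts (by rw [e0', hD.n]) (by rw [e0', hD.m])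
    (by rw [f2 3 (by decide), f1 3 (by decide), hs])
    (by rw [f2 4 (by decide), f1 4 (by decide), ht]) s.2.le t.2.le
    (fun h => hst (Fin.ext h)) (fun i hi => hhub.endpoints_le hi) hr₀).frame (fun σ₃ h => ?_) le_rfl
  obtain ⟨⟨k, hr, hms, hmt, hcl⟩, f3⟩ := h
  have e0'' : σ₃ 0 = σ 0 := (f3 0 (by decide)).trans e0'
  refine (pair_halts (by rw [e0'', hD.n]) (by rw [e0'', hD.m])
    (fun u => by rw [f3 1 (by decide), f2 1 (by decide), f1 1 (by decide), hout u])
    (fun u hu => ?_) (hhub.card_sender_eq hr)).mono le_rfl ?_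
  · obtain ⟨h2, h3, h4, h5⟩ := hhub.hub u hu
    have h6 := hr.reoriented (I.m + I.m + u) (by omega)
    have h7 := hr.reoriented (I.m + I.m + I.n + u) (by omega)
    omega
  · rintro σ₄ ⟨hp, hcov⟩
    have hpartner : ∀ u : Fin I.n, σ₄ 1 u ≠ 0 → ∃ v, (matchingOf (σ₄ 1)).Adj u v := by
      intro u hu
      -- Partners are distinct nodes, because the tail of the first hub arc of a node cannot be both
      -- the node and the hub.
      obtain ⟨v, h2, h3, h4, h5⟩ := (hp u u.2).resolve_left hu
      refine ⟨⟨v, h2⟩, fun he => ?_, h3, h4⟩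
      have h6 : v = u := by rw [he]
      subst h6
      have h7 := u.2
      simp only [sender, receiver] at h5
      omega
    -- The cut consists of the nodes marked by the last, unsuccessful search.
    refine ⟨matchingOf (σ₄ 1), fun u => ?_, hhub.isSolution hc hr (C := fun v => σ₃ 9 v ≠ 0) hms
      (by simpa using hmt) hcl (isReconfiguration_matchingOf _) ?_ ?_⟩
    · by_cases hu : σ₄ 1 u = 0
      · exact Or.inr ⟨fun v hv => by have := hv.2.1; omega, hu⟩
      · obtain ⟨v, hv⟩ := hpartner u hu
        exact Or.inl ⟨v, hv, hv.2.1⟩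
    · intro u v huv
      obtain ⟨w, h2, h3, h4, h5⟩ := (hp u u.2).resolve_left (by rw [huv.2.1]; omega)
      have h6 := huv.2.1
      obtain rfl : w = v := by omega
      exact h5
    · exact fun u hu => hpartner u (hcov u u.2 hu)

theorem locate_halts {σ : Memory} {P : Program} {T : ℕ} {Q : Memory → Prop} (hD : I.Reads (σ 0))
    (h0 : ∀ b ≠ 0, ∀ i, σ b i = 0) (hc : I.IsCommodity s t a)
    (h : ∀ σ', σ' 0 = σ 0 → σ' 1 = (fun _ => 0) → σ' 3 0 = (s : ℕ) → σ' 4 0 = (t : ℕ) → Halts P σ' T Q) :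
    Halts (seekDemand ;; scanDemand ;; P) σ
      (30 * (I.n + 3) + (40 * (I.n * I.n + I.n + 1) + T)) Q := by
  refine Halts.seq (seekDemand_halts hD (h0 5 (by decide) 0)).frame (fun σ₁ h => ?_) le_rfl
  obtain ⟨h2, f1⟩ := h
  have e0 : σ₁ 0 = σ 0 := f1 0 (by decide)
  refine Halts.seq (scanDemand_halts (by rwa [e0]) hc h2
    (by rw [f1 3 (by decide), h0 3 (by decide)])
    (by rw [f1 4 (by decide), h0 4 (by decide)])).frame (fun σ₂ h' => ?_) le_rfl
  obtain ⟨⟨h3, h4⟩, f2⟩ := h'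
  refine h σ₂ ((f2 0 (by decide)).trans e0) (funext fun i => ?_) h3 h4
  rw [f2 1 (by decide), f1 1 (by decide), h0 1 one_ne_zero]

theorem isProper_eval {σ : Memory} (hs : σ 3 0 = s) (ht : σ 4 0 = t) :
    isProper.eval σ = 0 ↔ s = t := by
  simp only [isProper, Expr.eval, hs, ht, Fin.ext_iff]
  omega

theorem skip_halts_of_eq {σ : Memory} {τ : Routing} (hc : I.IsCommodity s t a) (hst : s = t)
    (h1 : σ 1 = fun _ => 0) {T : ℕ} (hT : 1 ≤ T) :
    Halts Program.skip σ T fun σ' => Solves I τ (σ' 1) := by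
  subst hst
  refine LoopFree.halts (P := Program.skip) trivial hT ⟨⊥, ?_, Instance.isSolution_bot_of_eq τ hc⟩
  rw [exec, h1]
  exact represents_bot

theorem unsplittable_halts {σ : Memory} (hc : I.IsCommodity s t a) (hst : s ≠ t)
    (hs : σ 3 0 = s) (ht : σ 4 0 = t) (hout : σ 1 = fun _ => 0) :
    Halts (write 1 (var 3) (Expr.add (var 4) (Expr.const 1)) ;;
      write 1 (var 4) (Expr.add (var 3) (Expr.const 1))) σ 30
      fun σ' => Solves I Routing.UN (σ' 1) := by
  refine LoopFree.halts (by simp [LoopFree]) (by decide)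
    ⟨SimpleGraph.edge s t, fun u => ?_, Instance.isSolution_edge hc hst⟩
  have hne : (s : ℕ) ≠ t := fun h => hst (Fin.ext h)
  simp only [exec, Expr.eval, Function.update_self, ne_eq, not_false_eq_true,
    Function.update_of_ne, OfNat.ofNat_ne_one, hs, ht, hout, SimpleGraph.edge_adj]
  by_cases hus : u = s
  · subst hus
    exact Or.inl ⟨t, ⟨Or.inl ⟨rfl, rfl⟩, hst⟩, by simp [Function.update_of_ne hne]⟩
  by_cases hut : u = t
  · subst hut
    exact Or.inl ⟨s, ⟨Or.inr ⟨rfl, rfl⟩, fun h => hst h.symm⟩, by simp⟩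
  · refine Or.inr ⟨by simp [hus, hut], ?_⟩
    rw [Function.update_of_ne fun h => hut (Fin.ext h), Function.update_of_ne fun h => hus (Fin.ext h)]

theorem initial_reads (I : Instance) : I.Reads (initial I.encode 0) := by
  have : initial I.encode 0 = fun i => I.encode.getD i 0 := by
    funext i
    simp [initial]
  rw [this]
  exact I.reads_encode

theorem initial_eq_zero (w : List ℕ) : ∀ b ≠ 0, ∀ i, initial w b i = 0 := fun _ hb _ => if_neg hb

theorem polyTimeSolvable_of_halts {α : Type} {enc : α → List ℕ} {admissible : α → Prop}
    {R : α → (ℕ → ℕ) → Prop} (P : Program) (p : Polynomial ℕ)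
    (h : ∀ x, admissible x →
      Halts P (initial (enc x)) (p.eval (inputSize (enc x))) fun σ => R x (σ 1)) :
    PolyTimeSolvable enc admissible R := ⟨P, p, h⟩

end MCRN

theorem mainTheorem8 (τ : MCRN.Routing) :
    MCRN.PolyTimeSolvable MCRN.Instance.encode
      (fun I => I.SingleCommodity ∧ I.UniformCapacities)
      (fun I out => ∃ M : SimpleGraph (Fin I.n), I.Represents out M ∧ I.IsSolution τ M) := by
  open MCRN MCRN.Program Polynomial in
  cases τ with
  | SN =>
    refine polyTimeSolvable_of_halts solveSplittable
      -- The sum of the time bounds of all phases, with both the number of nodes and the number of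
      -- links replaced by the input size; the bare 30 pays for the test of s ≠ t.
      (30 * (X + 3) + (40 * (X * X + X + 1) + (30 + (200 * (X + 2) + (200 * (X + 2) +
        (400 * (X + X + X + X + 3) * ((X + 1) * (X + X + X + X + 1) + X + 4) +
          200 * (X + X + 2))))))) ?_
    rintro I ⟨h₁, h₂⟩
    obtain ⟨s, t, a, hc⟩ := Instance.IsCommodity.exists h₁ h₂
    have hcost : isProper.cost + 1 ≤ 30 := by decide
    refine (locate_halts (T := 30 + (200 * (I.m + 2) + (200 * (I.n + 2) +
        (400 * (I.m + I.m + I.n + I.n + 3) * ((I.n + 1) * (I.m + I.m + I.n + I.n + 1) + I.n + 4) +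
          200 * (I.n + I.n + 2))))) (initial_reads I) (initial_eq_zero _) hc fun σ h0 h1 h3 h4 =>
      Halts.ite (fun hb => ?_) (fun hb => ?_) (Nat.add_le_add_right hcost _)).mono ?_ fun _ h => h
    · exact splittable_halts (by rw [h0]; exact initial_reads I) hc
        (fun h => hb ((isProper_eval h3 h4).2 h)) h3 h4 (fun u => by rw [h1])
    · exact skip_halts_of_eq hc ((isProper_eval h3 h4).1 hb) h1 (by omega)
    · have hn := I.n_le_inputSize
      have hm := I.m_le_inputSize
      simp only [eval_add, eval_mul, eval_X, eval_ofNat, eval_one]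
      gcongr
  | UN =>
    refine polyTimeSolvable_of_halts solveUnsplittable
      (30 * (X + 3) + (40 * (X * X + X + 1) + 60)) ?_
    rintro I ⟨h₁, h₂⟩
    obtain ⟨s, t, a, hc⟩ := Instance.IsCommodity.exists h₁ h₂
    refine (locate_halts (T := 60) (initial_reads I) (initial_eq_zero _) hc fun σ h0 h1 h3 h4 =>
      Halts.ite (T := 30) (fun hb => ?_) (fun hb => ?_) (by decide)).mono ?_ fun _ h => h
    · exact unsplittable_halts hc (fun h => hb ((isProper_eval h3 h4).2 h)) h3 h4 h1
    · exact skip_halts_of_eq hc ((isProper_eval h3 h4).1 hb) h1 (by omega)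
    · have hn := I.n_le_inputSize
      simp only [eval_add, eval_mul, eval_X, eval_ofNat, eval_one]
      gcongr
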